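/- **Theorem 1.1.** Let $\Gamma$ be a finite simple graph with vertex set $V(\Gamma)$, let $\mathcal G=\{G_v\}_{v\in V(\Gamma)}$ be a family of countable groups, and let $G=\mathbb{GP}(\Gamma,\mathcal G)$ be the graph product, i.e. the quotient of the free product of the groups $G_v$ by the normal closure of all commutators $[g,h]$ with $g\in G_u$, $h\in G_v$ and $\{u,v\}$ an edge of $\Gamma$. Assume that the graph product is non-degenerate (every $G_v$ is non-trivial and $\Gamma$ does not consist of a single vertex) and that $\operatorname{diam}(\Gamma)\ge 2$, where the diameter is taken with respect to the edge metric on $V(\Gamma)$ and is $\infty$ if $\Gamma$ is disconnected. Then $G$ is acylindrically arboreal if and only if $G$ is not virtually cyclic and there exists a separated pair of vertices $a,b\in V(\Gamma)$. Here $a,b$ are *separated* if their edge distance in $\Gamma$ is at least $2$ (possibly $\infty$) and the subgroup of $G$ generated by the vertex groups $G_v$, with $v$ ranging over the vertices adjacent to both $a$ and $b$, is finite. A group is *virtually cyclic* if it has a cyclic subgroup of finite index (in particular, finite groups are virtually cyclic). A group $G$ is *acylindrically arboreal* if it acts by simplicial automorphisms without inversions on some simplicial tree $T$ with edge metric $d$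 such that the action is * *acylindrical*: for every $\epsilon\ge 0$ there are $R,N\ge 0$ such that for all $x,y\in T$ with $d(x,y)\ge R$ at most $N$ elements $g\in G$ satisfy $d(x,gx)\le\epsilon$ and $d(y,gy)\le\epsilon$; and * *non-elementary*: $G$ contains infinitely many pairwise independent loxodromic elements, where $g$ is loxodromic if $n\mapsto g^nx$ is a quasi-isometric embedding $\mathbb Z\to T$ for every $x\in T$, and two loxodromic elements are independent if their pairs of fixed points on the boundary at infinity of $T$ are disjoint. -/

import Mathlib

/-! ### Virtually cyclic groups -/

/-- A group is virtually cyclic if it has a cyclic subgroup of finite index. -/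
def IsVirtuallyCyclic (G : Type*) [Group G] : Prop :=
  ∃ H : Subgroup G, IsCyclic H ∧ H.FiniteIndex

/-! ### Acylindrical actions on simplicial trees

A simplicial tree is given by its vertex set `T` and its graph `X : SimpleGraph T` with `X.IsTree`;
its edge metric on the vertices is `X.dist`. Every point of the tree is within `1/2` of a vertex, so
the coarse notions below are the same whether they are read on the vertices or on the whole tree. -/

section Action

variable {G T : Type*} [Group G] [MulAction G T]

/-- `G` acts on the graph `X` by graph automorphisms, and no element inverts an edge. -/
def ActsSimplicially (G : Type*) {T : Type*} [Group G] [MulAction G T]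
    (X : SimpleGraph T) : Prop :=
  (∀ (g : G) (x y : T), X.Adj (g • x) (g • y) ↔ X.Adj x y) ∧
    ∀ (g : G) (x y : T), X.Adj x y → ¬ (g • x = y ∧ g • y = x)

/-- The pointwise `ε`-quasi-stabiliser of `x` and `y`. -/
def pqStab (G : Type*) {T : Type*} [Group G] [MulAction G T]
    (X : SimpleGraph T) (ε : ℝ) (x y : T) : Set G :=
  {g : G | (X.dist x (g • x) : ℝ) ≤ ε ∧ (X.dist y (g • y) : ℝ) ≤ ε}

/-- Acylindricity in the sense of Bowditch. -/
def ActsAcylindrically (G : Type*) {T : Type*} [Group G] [MulAction G T]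
    (X : SimpleGraph T) : Prop :=
  ∀ ε : ℝ, 0 ≤ ε → ∃ R N : ℕ, ∀ x y : T, R ≤ X.dist x y → (pqStab G X ε x y).encard ≤ N

/-- `g` is loxodromic: each orbit map `n ↦ g ^ n • x` is a quasi-isometric embedding of `ℤ`. -/
def IsLoxodromic (X : SimpleGraph T) (g : G) : Prop :=
  ∀ x : T, ∃ K C : ℝ, 1 ≤ K ∧ 0 ≤ C ∧ ∀ m n : ℤ,
    K⁻¹ * |(m : ℝ) - n| - C ≤ X.dist (g ^ m • x) (g ^ n • x) ∧
      (X.dist (g ^ m • x) (g ^ n • x) : ℝ) ≤ K * |(m : ℝ) - n| + C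

/-- The Gromov product of `x` and `y` based at `o`. -/
noncomputable def gromovProd (X : SimpleGraph T) (o x y : T) : ℝ :=
  ((X.dist o x : ℝ) + X.dist o y - X.dist x y) / 2

/-- The sequences `g ^ m • o` and `h ^ n • o` converge to the same point of the Gromov boundary.
For loxodromic elements this says that their attracting fixed points at infinity agree. -/
def SameAttractingPoint (X : SimpleGraph T) (o : T) (g h : G) : Prop :=
  Filter.Tendsto (fun p : ℕ × ℕ => gromovProd X o (g ^ p.1 • o) (h ^ p.2 • o))
    Filter.atTop Filter.atTop

/-- Independence of loxodromic elements: the pairs of endpoints at infinity of `g` and `h` are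
disjoint (the repelling point of `g` is the attracting point of `g⁻¹`). -/
def AreIndependent (X : SimpleGraph T) (g h : G) : Prop :=
  ∀ o : T, ¬ SameAttractingPoint X o g h ∧ ¬ SameAttractingPoint X o g h⁻¹ ∧
    ¬ SameAttractingPoint X o g⁻¹ h ∧ ¬ SameAttractingPoint X o g⁻¹ h⁻¹

/-- The action is non-elementary: there are infinitely many (pairwise) independent loxodromics. -/
def ActsNonElementarily (G : Type*) {T : Type*} [Group G] [MulAction G T]
    (X : SimpleGraph T) : Prop :=
  ∃ S : Set G, S.Infinite ∧ (∀ g ∈ S, IsLoxodromic X g) ∧ S.Pairwise (AreIndependent X)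

end Action

/-- `G` admits a non-elementary acylindrical action (by simplicial automorphisms, without
inversions) on a simplicial tree. Such a tree contains an invariant subtree spanned by an orbit,
whose vertex set has a copy in the universe of `G`, so the universe of `T` is no restriction. -/
def IsAcylindricallyArboreal.{u} (G : Type u) [Group G] : Prop :=
  ∃ (T : Type u) (_ : MulAction G T) (X : SimpleGraph T),
    X.IsTree ∧ ActsSimplicially G X ∧ ActsAcylindrically G X ∧ ActsNonElementarily G X

/-! ### Graph products of groups -/

section GraphProduct

variable {V : Type*} (Γ : SimpleGraph V) (𝒢 : V → Type*) [∀ v, Group (𝒢 v)]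

/-- The commutators `[g, h]` of elements of adjacent vertex groups, in the free product. -/
def graphProductRels : Set (Monoid.CoprodI 𝒢) :=
  {r | ∃ (u v : V) (g : 𝒢 u) (h : 𝒢 v), Γ.Adj u v ∧
    r = Monoid.CoprodI.of g * Monoid.CoprodI.of h *
      (Monoid.CoprodI.of g)⁻¹ * (Monoid.CoprodI.of h)⁻¹}

/-- The graph product of the vertex groups `𝒢 v` over the graph `Γ`. -/
abbrev GraphProduct : Type _ :=
  Monoid.CoprodI 𝒢 ⧸ Subgroup.normalClosure (graphProductRels Γ 𝒢)

/-- The canonical map of a vertex group to the graph product. -/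
def GraphProduct.of (v : V) : 𝒢 v →* GraphProduct Γ 𝒢 :=
  (QuotientGroup.mk' (Subgroup.normalClosure (graphProductRels Γ 𝒢))).comp Monoid.CoprodI.of

/-- The full subgroup on `A`: the subgroup generated by the vertex groups of the vertices in `A`. -/
def fullSubgroup (A : Set V) : Subgroup (GraphProduct Γ 𝒢) :=
  ⨆ v ∈ A, (GraphProduct.of Γ 𝒢 v).range

/-- All vertex groups are non-trivial and `Γ` is not a single vertex. -/
def IsNonDegenerate (_ : SimpleGraph V) (𝒢 : V → Type*) [∀ v, Group (𝒢 v)] : Prop :=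
  (∀ v, Nontrivial (𝒢 v)) ∧ Nat.card V ≠ 1

/-- `a` and `b` are at edge distance at least two (possibly infinite) and the full subgroup on
their common link is finite. -/
def AreSeparated (a b : V) : Prop :=
  2 ≤ Γ.edist a b ∧ (fullSubgroup Γ 𝒢 (Γ.commonNeighbors a b) : Set (GraphProduct Γ 𝒢)).Finite

end GraphProduct

/-!
# Acylindrically arboreal graph products

**Trees.** The edge metric of a tree satisfies the four-point inequality, and this is the only way
in which its geometry is used. An automorphism without fixed vertices translates: there is `l > 0`
such that `d(x, g ^ n x) = |n| l + c` for all `n ≠ 0`, where `c` depends only on `x`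
(`ActsSimplicially.exists_translatesBy`). In an acylindrical action, a loxodromic element `t`
generates a subgroup of finite index in the stabiliser of its axis
(`TranslatesBy.relIndex_zpowers_ne_zero`). This has two consequences. An infinite group commuting
with `t` contains a power of `t` (`TranslatesBy.finite_of_commute`); and if the group is not
virtually cyclic, then `t` has infinitely many pairwise independent conjugates
(`ActsAcylindrically.actsNonElementarily`).

**A separated pair is necessary.** Suppose that there is none. If `u`, `v` are distinct and not
adjacent, then `⟨G_u, G_v⟩` commutes with the infinite full subgroup on the common link of `u` and
`v`, which it meets trivially, so its elements are not loxodromic. If `u` is adjacent to all other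
vertices, then `G_u` commutes with an infinite subgroup `⟨G_a, G_b⟩` and the same follows for its
elements. Hence all elements of vertex groups and all products of two of them have fixed vertices,
and by Serre's lemma (`ActsSimplicially.exists_common_fixed`) and the Helly property of subtrees
(`SimpleGraph.IsTree.helly`) so do all elements of the graph product `G`
(`exists_areSeparated`).

**A separated pair is sufficient.** Let `a`, `b` be separated, and let `L_s` be the full subgroup on
the link of `s`. The kernel of the retraction of `G` which kills `G_a` and `G_b` is a free product
`A_a * A_b`, where `A_s` is a free product of conjugates of `G_s` indexed by cosets of `L_s`.
Therefore `G` embeds in a semidirect product `(A_a * A_b) ⋊ G` (`splitHom_injective`), which acts on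
the Bass–Serre tree of `A_a * A_b`. An element fixing a long geodesic has an image under the
retraction which fixes a reduced word with letters in both `A_a` and `A_b`, and so
lies in a conjugate of `L_a` and in a conjugate of `L_b`. By means of retractions such an
intersection is seen to be conjugate into the finite full subgroup on the common link of `a` and `b`
(`encard_stabilizer_cosets_le`), so the action is acylindrical
(`ActsSimplicially.actsAcylindrically`). Products of non-trivial elements of `G_a` and `G_b` have no
fixed vertex, so the action is non-elementary unless `G` is virtually cyclic.
-/

/-! ### Metric properties of trees -/

namespace SimpleGraph

variable {T : Type*} {X : SimpleGraph T}

/-- A sequence with steps `±1` which never goes up and then immediately down decreases to its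
minimum and increases afterwards. -/
lemma exists_valley (h : ℕ → ℕ) (n : ℕ)
    (step : ∀ i < n, h (i + 1) = h i + 1 ∨ h i = h (i + 1) + 1)
    (peak : ∀ i, i + 2 ≤ n → h (i + 1) = h i + 1 → h (i + 1) = h (i + 2) + 1 → False) :
    ∃ i ≤ n, h 0 = h i + i ∧ ∀ j, i ≤ j → j ≤ n → h j = h i + (j - i) := by
  induction n with
  | zero =>
    refine ⟨0, le_rfl, rfl, fun j _ hj => ?_⟩
    obtain rfl : j = 0 := by omega
    rfl
  | succ n ih =>
    obtain ⟨i, hi, h0, hj⟩ := ih (fun i hi => step i (by omega)) (fun i hi => peak i (by omega))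
    rcases step n (by omega) with hs | hs
    · refine ⟨i, by omega, h0, fun j h1 h2 => ?_⟩
      rcases Nat.lt_or_ge n j with h3 | h3
      · obtain rfl : j = n + 1 := by omega
        have := hj n hi le_rfl
        omega
      · exact hj j h1 h3
    · rcases Nat.lt_or_ge i n with h3 | h3
      · obtain ⟨m, rfl⟩ : ∃ m, n = m + 1 := ⟨n - 1, by omega⟩
        have h4 := hj m (by omega) (by omega)
        have h5 := hj (m + 1) (by omega) (by omega)
        exact (peak m (by omega) (by omega) hs).elim
      · obtain rfl : i = n := by omega
        refine ⟨i + 1, le_rfl, by omega, fun j h1 h2 => ?_⟩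
        obtain rfl : j = i + 1 := by omega
        omega

/-- A graph is acyclic if it has a height function without two adjacent vertices of equal height,
such that each vertex has at most one lower neighbour: consider a highest vertex of a cycle. -/
lemma isAcyclic_of_height (δ : T → ℕ)
    (h1 : ∀ u v, X.Adj u v → δ u ≠ δ v)
    (h2 : ∀ u v w, X.Adj u v → X.Adj u w → δ v < δ u → δ w < δ u → v = w) : X.IsAcyclic := by
  classical
  intro v c hc
  obtain ⟨u, hu, hmax⟩ := c.support.toFinset.exists_max_image δ ⟨v, by simp⟩
  rw [List.mem_toFinset] at hu
  set d := c.rotate u hu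
  have hd : d.IsCycle := hc.rotate hu
  have hle : ∀ w ∈ d.support, δ w ≤ δ u := fun w hw => hmax w (by
    rwa [List.mem_toFinset, ← c.mem_support_rotate_iff u hu])
  have hs : X.Adj u d.snd := d.adj_snd hd.not_nil
  have hp : X.Adj u d.penultimate := (d.adj_penultimate hd.not_nil).symm
  refine hd.snd_ne_penultimate (h2 u _ _ hs hp ?_ ?_)
  · exact lt_of_le_of_ne (hle _ (d.getVert_mem_support _)) (h1 _ _ hs).symm
  · exact lt_of_le_of_ne (hle _ (d.getVert_mem_support _)) (h1 _ _ hp).symm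

/-- In a tree, a vertex `u` has at most one neighbour which is closer to `x`. -/
lemma IsTree.eq_of_adj_of_dist_add_one (hX : X.IsTree) {x u v w : T} (huv : X.Adj u v)
    (huw : X.Adj u w) (hv : X.dist x u = X.dist x v + 1) (hw : X.dist x u = X.dist x w + 1) :
    v = w := by
  obtain ⟨p, hp⟩ := hX.connected.exists_walk_length_eq_dist x v
  obtain ⟨q, hq⟩ := hX.connected.exists_walk_length_eq_dist x w
  have hp' : (p.concat huv.symm).IsPath :=
    Walk.isPath_of_length_eq_dist _ (by rw [Walk.length_concat]; omega)
  have hq' : (q.concat huw.symm).IsPath :=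
    Walk.isPath_of_length_eq_dist _ (by rw [Walk.length_concat]; omega)
  have h := congrArg (fun r : X.Path x u => r.1.penultimate)
    ((hX.isAcyclic.subsingleton_path x u).elim ⟨_, hp'⟩ ⟨_, hq'⟩)
  simpa using h

/-- Every vertex of a tree has a projection to each geodesic. -/
lemma IsTree.exists_projection (hX : X.IsTree) {z w : T} (p : X.Walk z w)
    (hp : p.length = X.dist z w) (x : T) :
    ∃ i ≤ p.length, X.dist x z = X.dist x (p.getVert i) + i ∧
      X.dist x w = X.dist x (p.getVert i) + (p.length - i) := by
  have hstep : ∀ i < p.length, X.Adj (p.getVert i) (p.getVert (i + 1)) :=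
    fun i hi => p.adj_getVert_succ hi
  obtain ⟨i, hi, h0, hj⟩ := exists_valley (fun i => X.dist x (p.getVert i)) p.length
    (fun i hi => by
      have := hX.dist_eq_dist_add_one_of_adj x (hstep i hi)
      omega)
    (fun i hi h1 h2 => by
      have h := hX.eq_of_adj_of_dist_add_one (hstep i (by omega)).symm (hstep (i + 1) (by omega))
        h1 h2
      have h3 : X.dist z (p.getVert i) ≤ i :=
        (dist_le (p.take i)).trans (by simp)
      have h4 : X.dist (p.getVert (i + 2)) w ≤ p.length - (i + 2) :=
        (dist_le (p.drop (i + 2))).trans (by simp)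
      have h5 := hX.connected.dist_triangle (u := z) (v := p.getVert i) (w := w)
      rw [h] at h3 h5
      change X.dist z (p.getVert (i + 2)) ≤ i at h3
      change _ ≤ X.dist z (p.getVert (i + 2)) + X.dist (p.getVert (i + 2)) w at h5
      omega)
  refine ⟨i, hi, by simpa using h0, ?_⟩
  simpa using hj p.length hi le_rfl

lemma Walk.dist_getVert_le {z w : T} (p : X.Walk z w) {i j : ℕ} (hij : i ≤ j) :
    X.dist (p.getVert i) (p.getVert j) ≤ j - i := by
  have h : (p.drop i).getVert (j - i) = p.getVert j := by
    rw [Walk.drop_getVert]; congr 1; omega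
  rw [← h]
  exact (dist_le ((p.drop i).take (j - i))).trans (by simp)

/-- The four-point inequality: trees are `0`-hyperbolic. -/
lemma IsTree.four_point (hX : X.IsTree) (x y z w : T) :
    X.dist x y + X.dist z w ≤ X.dist x z + X.dist y w ∨
      X.dist x y + X.dist z w ≤ X.dist x w + X.dist y z := by
  obtain ⟨p, hp⟩ := hX.connected.exists_walk_length_eq_dist z w
  obtain ⟨i, hi, hi1, hi2⟩ := hX.exists_projection p hp x
  obtain ⟨j, hj, hj1, hj2⟩ := hX.exists_projection p hp y
  have h1 := hX.connected.dist_triangle (u := x) (v := p.getVert i) (w := y)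
  have h2 := hX.connected.dist_triangle (u := p.getVert i) (v := p.getVert j) (w := y)
  have h3 := X.dist_comm (u := p.getVert j) (v := y)
  have h5 := X.dist_comm (u := p.getVert j) (v := p.getVert i)
  rcases le_total i j with hij | hij
  · have h4 := p.dist_getVert_le hij
    omega
  · have h4 := p.dist_getVert_le hij
    omega

/-- Trees are bipartite, so closed paths have even length. -/
lemma IsTree.even_perimeter (hX : X.IsTree) (x y z : T) :
    ∃ k, X.dist x y + X.dist y z + X.dist x z = 2 * k := by
  obtain ⟨p, hp⟩ := hX.connected.exists_walk_length_eq_dist y z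
  obtain ⟨i, hi, hi1, hi2⟩ := hX.exists_projection p hp x
  exact ⟨X.dist x (p.getVert i) + p.length, by omega⟩

lemma Connected.exists_dist_eq (hX : X.Connected) {x y : T} {k : ℕ} (hk : k ≤ X.dist x y) :
    ∃ m, X.dist x m = k ∧ X.dist x m + X.dist m y = X.dist x y := by
  obtain ⟨p, hp⟩ := hX.exists_walk_length_eq_dist x y
  have h3 : X.dist x (p.getVert k) ≤ k := (dist_le (p.take k)).trans (by simp)
  have h4 : X.dist (p.getVert k) y ≤ p.length - k := (dist_le (p.drop k)).trans (by simp)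
  have h5 := hX.dist_triangle (u := x) (v := p.getVert k) (w := y)
  exact ⟨p.getVert k, by omega, by omega⟩

/-- Medians: any three vertices of a tree have a vertex lying between any two of them. -/
lemma IsTree.exists_median (hX : X.IsTree) (x y z : T) :
    ∃ m, X.dist x m + X.dist m y = X.dist x y ∧ X.dist y m + X.dist m z = X.dist y z ∧
      X.dist x m + X.dist m z = X.dist x z := by
  obtain ⟨p, hp⟩ := hX.connected.exists_walk_length_eq_dist y z
  obtain ⟨i, hi, hi1, hi2⟩ := hX.exists_projection p hp x
  have h3 : X.dist y (p.getVert i) ≤ i := (dist_le (p.take i)).trans (by simp)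
  have h4 : X.dist (p.getVert i) z ≤ p.length - i := (dist_le (p.drop i)).trans (by simp)
  have h5 := hX.connected.dist_triangle (u := y) (v := p.getVert i) (w := z)
  have h6 := X.dist_comm (u := p.getVert i) (v := y)
  exact ⟨p.getVert i, by omega, by omega, by omega⟩

lemma IsTree.eq_of_between (hX : X.IsTree) {x y m n : T}
    (hm : X.dist x m + X.dist m y = X.dist x y) (hn : X.dist x n + X.dist n y = X.dist x y)
    (h : X.dist x m = X.dist x n) : m = n := by
  rw [← hX.connected.dist_eq_zero_iff]
  have h1 := hX.four_point m n x y
  have h2 := X.dist_comm (u := x) (v := m)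
  have h3 := X.dist_comm (u := x) (v := n)
  omega

/-- The geodesics from `a` to `x` and to `y` agree up to the distance `(x | y)` from `a`. -/
lemma IsTree.eq_of_branch (hX : X.IsTree) {a x y m n : T}
    (hm : X.dist a m + X.dist m x = X.dist a x) (hn : X.dist a n + X.dist n y = X.dist a y)
    (hmn : X.dist a m = X.dist a n) (hxy : 2 * X.dist a m + X.dist x y ≤ X.dist a x + X.dist a y) :
    m = n := by
  have h1 := hX.four_point n x a y
  have h2 := X.dist_comm (u := n) (v := a)
  have h3 := X.dist_comm (u := x) (v := a)
  have h4 : X.dist n x + X.dist a m ≤ X.dist a x := by omega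
  rw [← hX.connected.dist_eq_zero_iff]
  have h5 := hX.four_point m n a x
  have h6 := X.dist_comm (u := m) (v := a)
  omega

/-- An isometry `f` of a tree which does not move `f x` further away from `x` when it is applied
once more fixes the midpoint of the geodesic from `x` to `f x` or inverts its middle edge. -/
lemma IsTree.exists_fixed_or_swapped (hX : X.IsTree) {f : T → T}
    (hf : ∀ a b, X.dist (f a) (f b) = X.dist a b) (x : T)
    (hle : X.dist x (f (f x)) ≤ X.dist x (f x)) :
    (∃ m, f m = m) ∨ ∃ m n, X.Adj m n ∧ f m = n ∧ f n = m := by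
  have hxy := hf x (f x)
  have hm := fun m => hf x m
  have hn := fun m => hf m (f x)
  obtain ⟨e, he⟩ := hX.even_perimeter x (f x) (f (f x))
  generalize f (f x) = z at *
  generalize f x = y at *
  have h1 := X.dist_comm (u := z) (v := x)
  have h2 := X.dist_comm (u := y) (v := x)
  rcases Nat.even_or_odd' (X.dist x y) with ⟨k, hk | hk⟩
  · obtain ⟨m, hm1, hm2⟩ := hX.connected.exists_dist_eq (x := x) (y := y) (k := k) (by omega)
    have h3 := hm m
    have h4 := hn m
    have h5 := X.dist_comm (u := x) (v := m)
    have h6 := X.dist_comm (u := y) (v := m)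
    refine Or.inl ⟨m, ?_⟩
    generalize f m = m' at *
    refine hX.eq_of_branch (x := z) (y := x) (a := y) ?_ ?_ ?_ ?_ <;> omega
  · obtain ⟨m, hm1, hm2⟩ := hX.connected.exists_dist_eq (x := x) (y := y) (k := k) (by omega)
    obtain ⟨n, hn1, hn2⟩ := hX.connected.exists_dist_eq (x := x) (y := y) (k := k + 1) (by omega)
    have h5 := X.dist_comm (u := x) (v := m)
    have h6 := X.dist_comm (u := y) (v := m)
    have h5' := X.dist_comm (u := x) (v := n)
    have h6' := X.dist_comm (u := y) (v := n)
    refine Or.inr ⟨m, n, ?_, ?_, ?_⟩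
    · rw [← dist_eq_one_iff_adj]
      have h9 := hX.four_point m n x y
      have h10 := hX.connected.dist_triangle (u := x) (v := m) (w := n)
      omega
    · have h3 := hm m
      have h4 := hn m
      generalize f m = m' at *
      refine hX.eq_of_branch (x := z) (y := x) (a := y) ?_ ?_ ?_ ?_ <;> omega
    · have h3 := hm n
      have h4 := hn n
      generalize f n = n' at *
      refine hX.eq_of_branch (x := z) (y := x) (a := y) ?_ ?_ ?_ ?_ <;> omega

/-- A set of vertices is convex if it contains all vertices between any two of its points. -/
def IsGeodConvex (X : SimpleGraph T) (S : Set T) : Prop :=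
  ∀ x ∈ S, ∀ y ∈ S, ∀ m, X.dist x m + X.dist m y = X.dist x y → m ∈ S

/-- The Helly property of subtrees. -/
lemma IsTree.helly (hX : X.IsTree) (L : List (Set T))
    (hc : ∀ S ∈ L, IsGeodConvex X S) (hp : ∀ S ∈ L, ∀ S' ∈ L, (S ∩ S').Nonempty) :
    ∃ x, ∀ S ∈ L, x ∈ S := by
  induction hn : L.length generalizing L with
  | zero =>
    obtain ⟨o⟩ := hX.connected.nonempty
    rw [List.length_eq_zero_iff] at hn
    exact ⟨o, by simp [hn]⟩
  | succ n ih =>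
    obtain _ | ⟨S, L⟩ := L
    · simp at hn
    rcases eq_or_ne L [] with rfl | hL
    · obtain ⟨x, hx, -⟩ := hp S (by simp) S (by simp)
      exact ⟨x, by simpa using hx⟩
    have hSc := hc S (by simp)
    obtain ⟨x, hx⟩ := ih (L.map (· ∩ S)) (fun A hA => by
      obtain ⟨B, hB, rfl⟩ := List.mem_map.1 hA
      have hBc := hc B (by simp [hB])
      exact fun x hx y hy m hm => ⟨hBc x hx.1 y hy.1 m hm, hSc x hx.2 y hy.2 m hm⟩)
      (fun A hA A' hA' => by
        obtain ⟨B, hB, rfl⟩ := List.mem_map.1 hA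
        obtain ⟨B', hB', rfl⟩ := List.mem_map.1 hA'
        obtain ⟨x, hx1, hx2⟩ := hp B (by simp [hB]) B' (by simp [hB'])
        obtain ⟨y, hy1, hy2⟩ := hp B (by simp [hB]) S (by simp)
        obtain ⟨z, hz1, hz2⟩ := hp B' (by simp [hB']) S (by simp)
        obtain ⟨m, hm1, hm2, hm3⟩ := hX.exists_median x y z
        have h1 := hc B (by simp [hB]) x hx1 y hy1 m hm1
        have h2 := hc B' (by simp [hB']) x hx2 z hz1 m hm3
        have h3 := hSc y hy2 z hz2 m hm2
        exact ⟨m, ⟨h1, h3⟩, ⟨h2, h3⟩⟩) (by simpa using hn)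
    obtain ⟨B, hB⟩ := List.exists_mem_of_ne_nil L hL
    refine ⟨x, fun A hA => ?_⟩
    rcases List.mem_cons.1 hA with rfl | hA
    · exact (hx (B ∩ A) (List.mem_map.2 ⟨B, hB, rfl⟩)).2
    · exact (hx (A ∩ S) (List.mem_map.2 ⟨A, hA, rfl⟩)).1

end SimpleGraph

/-! ### Automorphisms of trees: fixed vertices and translations -/

section TreeActions

variable {G T : Type*} [Group G] [MulAction G T] {X : SimpleGraph T}

lemma ActsSimplicially.dist_smul_le (hX : X.Connected) (hG : ActsSimplicially G X) (g : G)
    (x y : T) : X.dist (g • x) (g • y) ≤ X.dist x y := by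
  obtain ⟨p, hp⟩ := hX.exists_walk_length_eq_dist x y
  let f : X →g X := ⟨fun x => g • x, fun {a b} h => (hG.1 g a b).2 h⟩
  rw [← hp, ← p.length_map f]
  exact SimpleGraph.dist_le (p.map f)

lemma ActsSimplicially.dist_smul (hX : X.Connected) (hG : ActsSimplicially G X) (g : G)
    (x y : T) : X.dist (g • x) (g • y) = X.dist x y := by
  refine le_antisymm (hG.dist_smul_le hX g x y) ?_
  simpa using hG.dist_smul_le hX g⁻¹ (g • x) (g • y)

lemma ActsSimplicially.dist_inv_smul (hX : X.Connected) (hG : ActsSimplicially G X) (g : G)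
    (x y : T) : X.dist (g⁻¹ • x) y = X.dist x (g • y) := by
  simpa using hG.dist_smul hX g⁻¹ x (g • y)

lemma ActsSimplicially.dist_zpow_smul (hX : X.Connected) (hG : ActsSimplicially G X) (g : G)
    (x : T) (m n : ℤ) : X.dist (g ^ m • x) (g ^ n • x) = X.dist x (g ^ (n - m) • x) := by
  rw [← hG.dist_smul hX (g ^ m) x, smul_smul, ← zpow_add]
  simp

/-- The alternative of an inverted edge is excluded for actions without inversions. -/
lemma ActsSimplicially.exists_fixed_or_dist_lt (hX : X.IsTree) (hG : ActsSimplicially G X) (g : G)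
    (x : T) : (∃ y : T, g • y = y) ∨ X.dist x (g • x) < X.dist x (g • g • x) := by
  by_contra! hcon
  rcases hX.exists_fixed_or_swapped (f := fun x => g • x) (hG.dist_smul hX.connected g) x hcon.2
    with ⟨m, hm⟩ | ⟨m, n, hmn, h1, h2⟩
  · exact hcon.1 m hm
  · exact hG.2 g m n hmn ⟨h1, h2⟩

/-- If `g` moves `g • x` further away from `x`, then distances along the orbit of `x` grow
linearly. -/
lemma ActsSimplicially.dist_pow_smul (hX : X.IsTree) (hG : ActsSimplicially G X) {g : G} {x : T}
    (h : X.dist x (g • x) < X.dist x (g • g • x)) :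
    ∃ l c : ℕ, 0 < l ∧ ∀ n : ℕ, n ≠ 0 → X.dist x (g ^ n • x) = n * l + c := by
  have hd := hG.dist_smul hX.connected g
  obtain ⟨l, hl⟩ : ∃ l, X.dist x (g • g • x) = X.dist x (g • x) + l :=
    ⟨_, (Nat.add_sub_of_le h.le).symm⟩
  have htri := hX.connected.dist_triangle (u := x) (v := g • x) (w := g • g • x)
  have h1 := hd x (g • x)
  have hpow : ∀ n : ℕ, g • g ^ n • x = g ^ (n + 1) • x := fun n => by
    rw [smul_smul, pow_succ']
  have key : ∀ n : ℕ, X.dist x (g ^ (n + 2) • x) = X.dist x (g ^ (n + 1) • x) + l ∧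
      X.dist x (g • x) < X.dist x (g ^ (n + 2) • x) := by
    intro n
    induction n with
    | zero =>
      simp only [zero_add, pow_one, pow_two, mul_smul]
      omega
    | succ n ih =>
      have h2 := hX.four_point x (g ^ (n + 2) • x) (g • x) (g ^ (n + 3) • x)
      have h3 := hX.four_point x (g ^ (n + 3) • x) (g • x) (g ^ (n + 2) • x)
      have h4 := hd x (g ^ (n + 2) • x)
      have h5 := hd x (g ^ (n + 1) • x)
      have h6 := hd (g ^ (n + 2) • x) x
      have h7 := hd (g ^ (n + 1) • x) x
      have h8 := hd (g ^ (n + 1) • x) (g ^ (n + 2) • x)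
      have h9 : X.dist (g ^ (n + 1) • x) (g ^ (n + 2) • x) = X.dist x (g • x) := by
        have := hG.dist_zpow_smul hX.connected g x ((n + 1 : ℕ) : ℤ) ((n + 2 : ℕ) : ℤ)
        simp only [zpow_natCast] at this
        rw [this]
        push_cast
        rw [show (n : ℤ) + 2 - (n + 1) = 1 by ring, zpow_one]
      simp only [hpow] at h4 h5 h6 h7 h8
      have h10 := X.dist_comm (u := g ^ (n + 2) • x) (v := x)
      have h11 := X.dist_comm (u := g ^ (n + 1) • x) (v := x)
      have h12 := X.dist_comm (u := g ^ (n + 2) • x) (v := g • x)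
      have h13 := X.dist_comm (u := g ^ (n + 3) • x) (v := g ^ (n + 2) • x)
      have h14 := X.dist_comm (u := g ^ (n + 3) • x) (v := g • x)
      change X.dist x (g ^ (n + 3) • x) = X.dist x (g ^ (n + 2) • x) + l ∧
        X.dist x (g • x) < X.dist x (g ^ (n + 3) • x)
      simp only [Nat.add_assoc, Nat.reduceAdd] at *
      omega
  refine ⟨l, 2 * X.dist x (g • x) - X.dist x (g • g • x), by omega, fun n hn => ?_⟩
  obtain ⟨n, rfl⟩ : ∃ m, n = m + 1 := ⟨n - 1, by omega⟩
  induction n with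
  | zero => rw [zero_add, pow_one]; omega
  | succ n ih =>
    have h3 : X.dist x (g ^ (n + 1 + 1) • x) = X.dist x (g ^ (n + 1) • x) + l := (key n).1
    rw [h3, ih (by omega)]
    ring

/-- `g` is a hyperbolic automorphism of the tree with translation length `l > 0`. The constant `c`
is twice the distance of `x` from the axis of `g`; this description avoids introducing the axis. -/
def TranslatesBy (X : SimpleGraph T) (g : G) (l : ℕ) : Prop :=
  0 < l ∧ ∀ x : T, ∃ c : ℕ, ∀ n : ℤ, n ≠ 0 → X.dist x (g ^ n • x) = n.natAbs * l + c

lemma le_of_forall_mul_le {a b M : ℕ} (h : ∀ n : ℕ, n ≠ 0 → n * a ≤ n * b + M) : a ≤ b := by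
  by_contra! hab
  have h1 := h (M + 1) (by omega)
  have h2 : (M + 1) * (b + 1) ≤ (M + 1) * a := Nat.mul_le_mul_left _ hab
  have h3 : (M + 1) * (b + 1) = (M + 1) * b + (M + 1) := by ring
  omega

lemma ActsSimplicially.dist_smul_le_add (hX : X.Connected) (hG : ActsSimplicially G X) (g : G)
    (x y : T) : X.dist y (g • y) ≤ X.dist x (g • x) + 2 * X.dist x y := by
  have h1 := hX.dist_triangle (u := y) (v := x) (w := g • y)
  have h2 := hX.dist_triangle (u := x) (v := g • x) (w := g • y)
  have h3 := hG.dist_smul hX g x y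
  have h4 := X.dist_comm (u := y) (v := x)
  omega

lemma ActsSimplicially.not_fixed_of_dist_lt (hX : X.IsTree) (hG : ActsSimplicially G X) {g : G}
    {x : T} (h : X.dist x (g • x) < X.dist x (g • g • x)) (y : T) : g • y ≠ y := by
  intro hy
  obtain ⟨l, c, hl, hn⟩ := hG.dist_pow_smul hX h
  have hpow : ∀ n : ℕ, g ^ n • y = y := fun n => by
    induction n with
    | zero => simp
    | succ n ih => rw [pow_succ, mul_smul, hy, ih]
  have : l ≤ 0 := le_of_forall_mul_le (M := 2 * X.dist y x) fun n h0 => by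
    have h1 := hn n h0
    have h2 := hG.dist_smul_le_add hX.connected (g ^ n) y x
    rw [hpow n, SimpleGraph.dist_self] at h2
    omega
  omega

/-- An automorphism of a tree without inversions and without a fixed vertex is hyperbolic. -/
lemma ActsSimplicially.exists_translatesBy (hX : X.IsTree) (hG : ActsSimplicially G X) {g : G}
    (hg : ∀ x : T, g • x ≠ x) : ∃ l, TranslatesBy X g l := by
  have hlt : ∀ x : T, X.dist x (g • x) < X.dist x (g • g • x) := fun x =>
    (hG.exists_fixed_or_dist_lt hX g x).resolve_left fun ⟨y, hy⟩ => hg y hy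
  have hex := fun x => hG.dist_pow_smul hX (hlt x)
  choose l c hl hlc using hex
  obtain ⟨o⟩ := hX.connected.nonempty
  have hle : ∀ x y, l x ≤ l y := fun x y =>
    le_of_forall_mul_le (M := c y + 2 * X.dist y x) fun n hn => by
      have h1 := hlc x n hn
      have h2 := hlc y n hn
      have h3 := hG.dist_smul_le_add hX.connected (g ^ n) y x
      omega
  refine ⟨l o, hl o, fun x => ⟨c x, fun n hn => ?_⟩⟩
  rw [le_antisymm (hle o x) (hle x o)]
  have h1 := hlc x n.natAbs (by omega)
  rw [← h1]
  rcases Int.natAbs_eq n with h | h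
  · rw [h, zpow_natCast, Int.natAbs_natCast]
  · have h2 := hG.dist_inv_smul hX.connected (g ^ n.natAbs) x x
    rw [h, zpow_neg, zpow_natCast, Int.natAbs_neg, Int.natAbs_natCast, X.dist_comm, h2]

lemma TranslatesBy.not_fixed (hX : X.IsTree) (hG : ActsSimplicially G X) {g : G} {l : ℕ}
    (hg : TranslatesBy X g l) (x : T) : g • x ≠ x := by
  obtain ⟨c, hc⟩ := hg.2 x
  have h1 := hc 1 (by omega)
  have h2 := hc 2 (by omega)
  refine hG.not_fixed_of_dist_lt hX (x := x) ?_ x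
  rw [zpow_one] at h1
  rw [zpow_two, mul_smul] at h2
  rw [h1, h2]
  have := hg.1
  simp only [Int.natAbs_one, Int.reduceAbs]
  omega

lemma TranslatesBy.isLoxodromic (hX : X.IsTree) (hG : ActsSimplicially G X) {g : G} {l : ℕ}
    (hg : TranslatesBy X g l) : IsLoxodromic X g := by
  intro x
  obtain ⟨c, hc⟩ := hg.2 x
  have hl : (1 : ℝ) ≤ l := by exact_mod_cast hg.1
  refine ⟨l, c, hl, by positivity, fun m n => ?_⟩
  have hinv : (l : ℝ)⁻¹ ≤ 1 := inv_le_one_of_one_le₀ hl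
  rw [hG.dist_zpow_smul hX.connected]
  rcases eq_or_ne m n with rfl | hmn
  · simp
  · rw [hc _ (by omega)]
    have h1 : (((n - m).natAbs : ℕ) : ℝ) = |(m : ℝ) - n| := by
      rw [Nat.cast_natAbs, Int.cast_abs, abs_sub_comm]
      push_cast
      rfl
    push_cast
    rw [h1]
    have h2 := abs_nonneg ((m : ℝ) - n)
    have h3 : (0 : ℝ) ≤ c := by positivity
    constructor <;> nlinarith

lemma IsLoxodromic.not_fixed {g : G} (hg : IsLoxodromic X g) (x : T) : g • x ≠ x := by
  intro hx
  obtain ⟨K, C, hK, hC, h⟩ := hg x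
  have hpow : ∀ n : ℕ, g ^ n • x = x := fun n => by
    induction n with
    | zero => simp
    | succ n ih => rw [pow_succ, mul_smul, hx, ih]
  obtain ⟨n, hn⟩ := exists_nat_gt (K * C)
  have h1 := (h n 0).1
  rw [zpow_natCast, hpow n, zpow_zero, one_smul, SimpleGraph.dist_self] at h1
  simp only [Int.cast_natCast, Int.cast_zero, sub_zero, Nat.abs_cast, Nat.cast_zero] at h1
  have hK0 : 0 < K := by linarith
  have h2 : K * (K⁻¹ * n - C) ≤ 0 := mul_nonpos_of_nonneg_of_nonpos hK0.le h1
  rw [mul_sub, mul_inv_cancel_left₀ hK0.ne'] at h2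
  linarith

/-! ### Fixed vertices of families of automorphisms -/

lemma ActsSimplicially.isGeodConvex_fixedBy (hX : X.IsTree) (hG : ActsSimplicially G X) (g : G) :
    X.IsGeodConvex (MulAction.fixedBy T g) := by
  intro x hx y hy m hm
  rw [MulAction.mem_fixedBy] at *
  have h1 := hG.dist_smul hX.connected g x m
  have h2 := hG.dist_smul hX.connected g m y
  rw [hx] at h1
  rw [hy] at h2
  exact hX.eq_of_between (by rw [h1, h2, hm]) hm h1

/-- If `y` is the point of the fixed tree of `h` nearest to `x`, then the geodesic from `x` to
`h • x` passes through `y`. -/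
lemma ActsSimplicially.dist_smul_of_nearest (hX : X.IsTree) (hG : ActsSimplicially G X) {h : G}
    {x y : T} (hy : h • y = y) (hmin : ∀ z : T, h • z = z → X.dist x y ≤ X.dist x z) :
    X.dist x (h • x) = 2 * X.dist x y := by
  have hd := hG.dist_smul hX.connected h
  have h1 := hd x y
  have h2 := hX.connected.dist_triangle (u := x) (v := y) (w := h • x)
  rw [hy] at h1
  have h3 := X.dist_comm (u := y) (v := h • x)
  by_contra hne
  obtain ⟨k, hk⟩ := hX.even_perimeter x y (h • x)
  obtain ⟨z, hz1, hz2⟩ := hX.connected.exists_dist_eq (x := x) (y := y)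
    (k := X.dist x y - 1) (by omega)
  suffices hz : h • z = z by
    have := hmin z hz
    omega
  rw [← hX.connected.dist_eq_zero_iff]
  have h4 := hd z y
  have h5 := hd x z
  rw [hy] at h4
  have h6 := hX.four_point (h • z) z x y
  have h7 := hX.four_point (h • z) x y (h • x)
  have h8 := X.dist_comm (u := h • x) (v := h • z)
  have h9 := X.dist_comm (u := x) (v := z)
  have h10 := X.dist_comm (u := x) (v := y)
  omega

/-- Serre's lemma: if `g`, `h` and `g * h` have fixed vertices, then `g` and `h` have a common
one; otherwise `g * h` would translate along the geodesic between the two fixed trees. -/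
lemma ActsSimplicially.exists_common_fixed (hX : X.IsTree) (hG : ActsSimplicially G X) {g h : G}
    (hg : ∃ x : T, g • x = x) (hh : ∃ x : T, h • x = x) (hgh : ∃ x : T, (g * h) • x = x) :
    ∃ x : T, g • x = x ∧ h • x = x := by
  have hex : ∃ n, ∃ x y : T, g • x = x ∧ h • y = y ∧ X.dist x y = n := by
    obtain ⟨x, hx⟩ := hg
    obtain ⟨y, hy⟩ := hh
    exact ⟨_, x, y, hx, hy, rfl⟩
  classical
  obtain ⟨x, y, hx, hy, hxy⟩ := Nat.find_spec hex
  have hmin : ∀ x' y' : T, g • x' = x' → h • y' = y' → X.dist x y ≤ X.dist x' y' :=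
    fun x' y' hx' hy' => hxy ▸ Nat.find_min' hex ⟨x', y', hx', hy', rfl⟩
  rcases Nat.eq_zero_or_pos (X.dist x y) with h0 | hpos
  · rw [hX.connected.dist_eq_zero_iff] at h0
    exact ⟨x, hx, h0 ▸ hy⟩
  exfalso
  have hdg := hG.dist_smul hX.connected g
  have hdh := hG.dist_smul hX.connected h
  have h1 := hG.dist_smul_of_nearest hX hy fun z hz => hmin x z hx hz
  have h2 := hG.dist_smul_of_nearest hX hx fun z hz => by
    rw [X.dist_comm, X.dist_comm (u := y)]
    exact hmin z y hz hy
  have h3 : X.dist x (g • h • x) = 2 * X.dist x y := by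
    have := hdg x (h • x)
    rw [hx] at this
    omega
  obtain ⟨z, hz⟩ := hgh
  refine hG.not_fixed_of_dist_lt hX (g := g * h) (x := x) ?_ z hz
  simp only [mul_smul]
  have h4 : X.dist x (g • h • g • h • x) = X.dist (h⁻¹ • x) (g • h • x) := by
    have := hdg x (h • g • h • x)
    rw [hx] at this
    rw [this, hG.dist_inv_smul hX.connected]
  rw [h3, h4]
  have h5 : X.dist (h⁻¹ • x) y = X.dist x y := by
    rw [hG.dist_inv_smul hX.connected, hy]
  have h6 : X.dist (h⁻¹ • x) x = 2 * X.dist x y := by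
    rw [hG.dist_inv_smul hX.connected, h1]
  have h7 : X.dist x (g • y) = X.dist x y := by
    have := hdg x y
    rwa [hx] at this
  have h8 : X.dist (g • y) (g • h • x) = X.dist x y := by
    have := hdh y x
    rw [hy] at this
    rw [hdg, this, X.dist_comm]
  have h9 := hX.four_point (h⁻¹ • x) x y (g • y)
  have h10 := hX.four_point (h⁻¹ • x) (g • y) x (g • h • x)
  have h11 := X.dist_comm (u := x) (v := y)
  have h12 := X.dist_comm (u := g • y) (v := x)
  omega

/-- Commuting elements with fixed vertices have a product with a fixed vertex. -/
lemma ActsSimplicially.exists_fixed_mul_of_commute (hX : X.IsTree) (hG : ActsSimplicially G X)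
    {g h : G} (hcomm : Commute g h) (hg : ∃ x : T, g • x = x) (hh : ∃ x : T, h • x = x) :
    ∃ x : T, (g * h) • x = x := by
  by_contra! hno
  obtain ⟨l, hl, hgh⟩ := hG.exists_translatesBy hX hno
  obtain ⟨x, hx⟩ := hg
  obtain ⟨y, hy⟩ := hh
  obtain ⟨c, hc⟩ := hgh x
  have : l ≤ 0 := le_of_forall_mul_le (M := 2 * X.dist y x) fun n hn => by
    have h1 := hc n (by omega)
    have hxn : g ^ n • x = x := (MulAction.stabilizer G x).pow_mem hx n
    have hyn : h ^ n • y = y := (MulAction.stabilizer G y).pow_mem hy n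
    have h2 := hG.dist_smul_le_add hX.connected (h ^ n) y x
    have h3 := hG.dist_smul hX.connected (g ^ n) x (h ^ n • x)
    rw [zpow_natCast, hcomm.mul_pow, mul_smul, Int.natAbs_natCast] at h1
    rw [hxn] at h3
    rw [hyn, SimpleGraph.dist_self] at h2
    omega
  omega

/-- A product of elements which pairwise have common fixed vertices has a fixed vertex. -/
lemma ActsSimplicially.exists_fixed_list_prod (hX : X.IsTree) (hG : ActsSimplicially G X)
    (L : List G) (hL : ∀ g ∈ L, ∀ h ∈ L, ∃ x : T, g • x = x ∧ h • x = x) :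
    ∃ x : T, L.prod • x = x := by
  obtain ⟨x, hx⟩ := hX.helly (L.map (MulAction.fixedBy T))
    (fun S hS => by
      obtain ⟨g, -, rfl⟩ := List.mem_map.1 hS
      exact hG.isGeodConvex_fixedBy hX g)
    (fun S hS S' hS' => by
      obtain ⟨g, hg, rfl⟩ := List.mem_map.1 hS
      obtain ⟨h, hh, rfl⟩ := List.mem_map.1 hS'
      obtain ⟨x, hx⟩ := hL g hg h hh
      exact ⟨x, hx⟩)
  exact ⟨x, (MulAction.stabilizer G x).list_prod_mem fun g hg =>
    hx (MulAction.fixedBy T g) (List.mem_map.2 ⟨g, hg, rfl⟩)⟩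

end TreeActions

/-! ### Loxodromic elements -/

section Loxodromic

variable {G T : Type*} [Group G] [MulAction G T] {X : SimpleGraph T}

lemma IsLoxodromic.exists_translatesBy (hX : X.IsTree) (hG : ActsSimplicially G X) {g : G}
    (hg : IsLoxodromic X g) : ∃ l, TranslatesBy X g l :=
  hG.exists_translatesBy hX hg.not_fixed

lemma TranslatesBy.inv {g : G} {l : ℕ} (hg : TranslatesBy X g l) : TranslatesBy X g⁻¹ l := by
  refine ⟨hg.1, fun x => ?_⟩
  obtain ⟨c, hc⟩ := hg.2 x
  refine ⟨c, fun n hn => ?_⟩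
  rw [inv_zpow', hc (-n) (by omega), Int.natAbs_neg]

lemma TranslatesBy.conj (hX : X.IsTree) (hG : ActsSimplicially G X) {g : G} {l : ℕ}
    (hg : TranslatesBy X g l) (h : G) : TranslatesBy X (h * g * h⁻¹) l := by
  refine ⟨hg.1, fun x => ?_⟩
  obtain ⟨c, hc⟩ := hg.2 (h⁻¹ • x)
  refine ⟨c, fun n hn => ?_⟩
  rw [← hc n hn, conj_zpow, hG.dist_inv_smul hX.connected]
  simp only [mul_smul]

lemma TranslatesBy.zpow_ne_one {g : G} {l : ℕ} (hg : TranslatesBy X g l) (hX : X.IsTree)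
    {n : ℤ} (hn : n ≠ 0) : g ^ n ≠ 1 := by
  intro h
  obtain ⟨o⟩ := hX.connected.nonempty
  obtain ⟨c, hc⟩ := hg.2 o
  have h1 := hc n hn
  rw [h, one_smul, SimpleGraph.dist_self] at h1
  have h2 := Nat.mul_pos (Int.natAbs_pos.2 hn) hg.1
  omega

/-! ### The commensurator of a hyperbolic element -/

/-- `g` conjugates some non-trivial power `t ^ n` to `t ^ (ε * n)`; it preserves the axis of the
hyperbolic element `t`, and its orientation if `ε = 1`. -/
def CommensuratesWith (t : G) (ε : ℤˣ) (g : G) : Prop :=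
  ∃ n : ℤ, n ≠ 0 ∧ g * t ^ n * g⁻¹ = t ^ ((ε : ℤ) * n)

lemma CommensuratesWith.mul {t g h : G} {ε δ : ℤˣ} (hg : CommensuratesWith t ε g)
    (hh : CommensuratesWith t δ h) : CommensuratesWith t (ε * δ) (g * h) := by
  obtain ⟨n, hn, hgn⟩ := hg
  obtain ⟨m, hm, hhm⟩ := hh
  refine ⟨m * n, mul_ne_zero hm hn, ?_⟩
  have h1 : h * t ^ (m * n) * h⁻¹ = t ^ (n * (δ * m)) := by
    rw [zpow_mul, ← conj_zpow, hhm, ← zpow_mul]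
    ring_nf
  calc g * h * t ^ (m * n) * (g * h)⁻¹ = g * (h * t ^ (m * n) * h⁻¹) * g⁻¹ := by group
    _ = (g * t ^ n * g⁻¹) ^ (δ * m : ℤ) := by rw [h1, zpow_mul, ← conj_zpow]
    _ = _ := by
      rw [hgn, ← zpow_mul]
      push_cast
      ring_nf

lemma CommensuratesWith.inv {t g : G} {ε : ℤˣ} (hg : CommensuratesWith t ε g) :
    CommensuratesWith t ε g⁻¹ := by
  obtain ⟨n, hn, hgn⟩ := hg
  refine ⟨n, hn, ?_⟩
  have h1 : g⁻¹ * t ^ ((ε : ℤ) * n) * g = t ^ n := by rw [← hgn]; group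
  have hε : ((ε : ℤ) * ε) = 1 := by
    rw [← Units.val_mul, Int.units_mul_self, Units.val_one]
  calc g⁻¹ * t ^ n * g⁻¹⁻¹ = g⁻¹ * (t ^ ((ε : ℤ) * n)) ^ (ε : ℤ) * g⁻¹⁻¹ := by
        rw [← zpow_mul, show (ε : ℤ) * n * ε = n * (ε * ε) by ring, hε, mul_one]
    _ = (g⁻¹ * t ^ ((ε : ℤ) * n) * g⁻¹⁻¹) ^ (ε : ℤ) := by rw [conj_zpow]
    _ = _ := by rw [inv_inv, h1, ← zpow_mul, mul_comm]

lemma CommensuratesWith.zpow_mul {t g : G} {ε : ℤˣ} {n : ℤ}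
    (h : g * t ^ n * g⁻¹ = t ^ ((ε : ℤ) * n)) (k : ℤ) :
    g * t ^ (n * k) * g⁻¹ = t ^ ((ε : ℤ) * n * k) := by
  rw [_root_.zpow_mul, ← conj_zpow, h, ← _root_.zpow_mul]

/-- The elements preserving the axis of the hyperbolic element `t`, described algebraically. -/
def axisStabilizer (t : G) : Subgroup G where
  carrier := {g | ∃ ε, CommensuratesWith t ε g}
  mul_mem' := fun ⟨ε, hε⟩ ⟨δ, hδ⟩ => ⟨ε * δ, hε.mul hδ⟩
  one_mem' := ⟨1, 1, one_ne_zero, by simp⟩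
  inv_mem' := fun ⟨ε, hε⟩ => ⟨ε, hε.inv⟩

lemma mem_axisStabilizer_of_commute {t g : G} (h : Commute g t) : g ∈ axisStabilizer t :=
  ⟨1, 1, one_ne_zero, by rw [zpow_one, h.eq]; simp⟩

lemma zpowers_le_axisStabilizer (t : G) : Subgroup.zpowers t ≤ axisStabilizer t := by
  rw [Subgroup.zpowers_le]
  exact mem_axisStabilizer_of_commute (Commute.refl t)

/-- The orbit of `⟨t⟩` is coarsely dense in the axis of `t`: if the orbit `t ^ (i * n) • z` grows
as that of `o`, then `z` is close to the orbit of `o`. -/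
lemma TranslatesBy.exists_dist_le (hX : X.IsTree) (hG : ActsSimplicially G X) {t : G} {l c : ℕ}
    {o z : T} (hl : 0 < l) (ho : ∀ n : ℤ, n ≠ 0 → X.dist o (t ^ n • o) = n.natAbs * l + c) {k : ℤ}
    (hk : k ≠ 0) (hz : ∀ i : ℤ, i ≠ 0 → X.dist z (t ^ (k * i) • z) = (k * i).natAbs * l + c) :
    ∃ n : ℤ, X.dist z (t ^ n • o) ≤ c + l := by
  have hd := fun n : ℤ => hG.dist_smul hX.connected (t ^ n)
  set D := X.dist o z with hD
  obtain ⟨N, hN0, hN, hNz⟩ : ∃ N : ℤ, 0 < N ∧ (D : ℤ) < N ∧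
      (X.dist z (t ^ N • z) : ℤ) = N * l + c := by
    have hk1 : 0 < |k| := abs_pos.2 hk
    refine ⟨|k| * (D + 1), by positivity, by nlinarith, ?_⟩
    have h1 := hz (k.sign * (D + 1)) (mul_ne_zero (by simpa using hk) (by omega))
    rw [← mul_assoc, mul_comm k, Int.sign_mul_self_eq_abs] at h1
    rw [h1]
    push_cast
    rw [abs_of_pos (by positivity)]
  have hoN : (X.dist o (t ^ N • o) : ℤ) = N * l + c := by
    rw [ho N (by omega)]; push_cast; rw [abs_of_pos hN0]
  have hA : N ≤ N * l := by nlinarith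
  have e1 : X.dist o (t ^ N • z) = X.dist z (t ^ (-N) • o) := by
    rw [zpow_neg, X.dist_comm, X.dist_comm (u := z), hG.dist_inv_smul hX.connected, X.dist_comm]
  have e2 := X.dist_comm (u := t ^ N • o) (v := z)
  have e3 := X.dist_comm (u := t ^ N • z) (v := z)
  have e4 := hd N o z
  have hsum : (X.dist z (t ^ (-N) • o) : ℤ) + X.dist z (t ^ N • o) = 2 * (N * l) + 2 * c := by
    have h1 := hX.four_point o (t ^ N • o) z (t ^ N • z)
    have h2 := hX.four_point o (t ^ N • z) (t ^ N • o) z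
    have h3 := X.dist_comm (u := t ^ N • z) (v := t ^ N • o)
    omega
  have b1 : (X.dist z (t ^ N • o) : ℤ) ≤ N * l + c + D := by
    have := hX.connected.dist_triangle (u := z) (v := t ^ N • z) (w := t ^ N • o)
    have := X.dist_comm (u := t ^ N • z) (v := t ^ N • o)
    omega
  have b2 : (N * l + c : ℤ) ≤ X.dist z (t ^ N • o) + D := by
    have := hX.connected.dist_triangle (u := z) (v := t ^ N • o) (w := t ^ N • z)
    omega
  set δ : ℤ := X.dist z (t ^ (-N) • o) - X.dist z (t ^ N • o) with hδ
  have hl2 : (0 : ℤ) < 2 * l := by omega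
  -- `n` is chosen so that `t ^ n • o` and `z` project to nearby points of the axis
  set n : ℤ := δ / (2 * l) with hn
  have q1 : 2 * l * n ≤ δ := Int.mul_ediv_self_le (by omega)
  have q2 : δ < 2 * l * n + 2 * l := by
    have := Int.lt_ediv_add_one_mul_self δ hl2
    rw [← hn] at this
    linarith
  have hnN : n < N := by nlinarith
  have hNn : -N < n := by nlinarith
  have d1 : (X.dist (t ^ n • o) (t ^ N • o) : ℤ) = N * l - n * l + c := by
    rw [hG.dist_zpow_smul hX.connected, ho _ (by omega)]
    push_cast
    rw [abs_of_pos (by omega)]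
    ring
  have d2 : (X.dist (t ^ n • o) (t ^ (-N) • o) : ℤ) = N * l + n * l + c := by
    rw [hG.dist_zpow_smul hX.connected, ho _ (by omega)]
    push_cast
    rw [abs_of_neg (by omega)]
    ring
  have d3 : (X.dist (t ^ (-N) • o) (t ^ N • o) : ℤ) = 2 * (N * l) + c := by
    rw [hG.dist_zpow_smul hX.connected, ho _ (by omega)]
    push_cast
    rw [abs_of_pos (by omega)]
    ring
  refine ⟨n, ?_⟩
  have h4 := hX.four_point z (t ^ n • o) (t ^ (-N) • o) (t ^ N • o)
  have e5 : (2 * l * n : ℤ) = 2 * (n * l) := by ring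
  rw [e5] at q1 q2
  omega

/-- An element which commutes with a power of `t` moves all points of an orbit of `⟨t⟩` by about
the same distance. -/
lemma TranslatesBy.dist_smul_le_of_commensurates (hX : X.IsTree) (hG : ActsSimplicially G X)
    {t u : G} {l c : ℕ} {o : T}
    (ho : ∀ n : ℤ, n ≠ 0 → X.dist o (t ^ n • o) = n.natAbs * l + c)
    (hu : CommensuratesWith t 1 u) (r : ℕ) :
    X.dist (t ^ (r : ℤ) • o) (u • t ^ (r : ℤ) • o) ≤ X.dist o (u • o) + c := by
  rcases Nat.eq_zero_or_pos r with rfl | hr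
  · simp
  obtain ⟨k, hk, hku⟩ := hu
  have hd := hG.dist_smul hX.connected u
  obtain ⟨N, hN, hNu⟩ : ∃ N : ℤ, (r : ℤ) < N ∧ u * t ^ N = t ^ N * u := by
    have hk1 : 0 < |k| := abs_pos.2 hk
    refine ⟨k * (k.sign * (r + 1)), ?_, ?_⟩
    · rw [← mul_assoc, mul_comm k, Int.sign_mul_self_eq_abs]
      nlinarith
    · have := CommensuratesWith.zpow_mul hku (k.sign * (r + 1))
      rw [Units.val_one, one_mul] at this
      exact mul_inv_eq_iff_eq_mul.1 this
  have d1 : (X.dist o (t ^ (r : ℤ) • o) : ℤ) = r * l + c := by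
    rw [ho _ (by omega)]; push_cast; rw [abs_of_pos (by omega)]
  have d2 : (X.dist o (t ^ N • o) : ℤ) = N * l + c := by
    rw [ho _ (by omega)]; push_cast; rw [abs_of_pos (by omega)]
  have d3 : (X.dist (t ^ (r : ℤ) • o) (t ^ N • o) : ℤ) = N * l - r * l + c := by
    rw [hG.dist_zpow_smul hX.connected, ho _ (by omega)]
    push_cast
    rw [abs_of_pos (by omega)]
    ring
  have d4 : X.dist (t ^ N • o) (u • t ^ N • o) = X.dist o (u • o) := by
    rw [smul_smul, hNu, mul_smul, hG.dist_smul hX.connected]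
  have h1 := hd o (t ^ (r : ℤ) • o)
  have h2 := hd (t ^ (r : ℤ) • o) (t ^ N • o)
  generalize t ^ (r : ℤ) • o = y at *
  generalize t ^ N • o = w at *
  have h3 := hX.four_point y (u • y) o w
  have h4 := hX.connected.dist_triangle (u := u • y) (v := u • w) (w := w)
  have h5 := hX.connected.dist_triangle (u := u • y) (v := u • o) (w := o)
  have h6 := X.dist_comm (u := o) (v := y)
  have h7 := X.dist_comm (u := u • o) (v := u • y)
  have h8 := X.dist_comm (u := u • o) (v := o)
  have h9 := X.dist_comm (u := u • w) (v := w)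
  generalize (N * l : ℤ) = A at *
  generalize (r * l : ℤ) = B at *
  generalize u • y = y' at *
  generalize u • o = o' at *
  generalize u • w = w' at *
  omega

lemma ActsAcylindrically.exists_finite (hA : ActsAcylindrically G X) (M : ℕ) :
    ∃ R : ℕ, ∀ x y : T, R ≤ X.dist x y →
      {g : G | X.dist x (g • x) ≤ M ∧ X.dist y (g • y) ≤ M}.Finite := by
  obtain ⟨R, N, h⟩ := hA M (by positivity)
  refine ⟨R, fun x y hxy => ?_⟩
  have h1 : (pqStab G X M x y).Finite := Set.finite_of_encard_le_coe (h x y hxy)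
  refine h1.subset fun g hg => ?_
  simpa [pqStab] using hg

lemma TranslatesBy.finite_commensurates (hX : X.IsTree) (hG : ActsSimplicially G X)
    (hA : ActsAcylindrically G X) {t : G} {l : ℕ} (ht : TranslatesBy X t l) (o : T) (M : ℕ) :
    {u : G | CommensuratesWith t 1 u ∧ X.dist o (u • o) ≤ M}.Finite := by
  obtain ⟨c, hc⟩ := ht.2 o
  obtain ⟨R, hR⟩ := hA.exists_finite (M + c)
  have h1 : R ≤ X.dist o (t ^ ((R + 1 : ℕ) : ℤ) • o) := by
    rw [hc _ (by omega), Int.natAbs_natCast]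
    have := ht.1
    nlinarith
  refine (hR _ _ h1).subset fun u hu => ⟨by have := hu.2; omega, ?_⟩
  have h2 := TranslatesBy.dist_smul_le_of_commensurates hX hG hc hu.1 (R + 1)
  have := hu.2
  omega

lemma TranslatesBy.finite_axisStabilizer (hX : X.IsTree) (hG : ActsSimplicially G X)
    (hA : ActsAcylindrically G X) {t : G} {l : ℕ} (ht : TranslatesBy X t l) (o : T) (M : ℕ) :
    {u : G | u ∈ axisStabilizer t ∧ X.dist o (u • o) ≤ M}.Finite := by
  have h1 := ht.finite_commensurates hX hG hA o M
  have h2 : {u : G | CommensuratesWith t (-1) u ∧ X.dist o (u • o) ≤ M}.Finite := by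
    rcases Set.eq_empty_or_nonempty {u : G | CommensuratesWith t (-1) u ∧ X.dist o (u • o) ≤ M}
      with h | ⟨v, hv, hvM⟩
    · rw [h]
      exact Set.finite_empty
    -- two elements reversing the axis differ by one preserving its orientation
    refine ((ht.finite_commensurates hX hG hA o (2 * M)).image (v * ·)).subset fun u hu => ?_
    refine ⟨v⁻¹ * u, ⟨by simpa using hv.inv.mul hu.1, ?_⟩, by simp⟩
    have h3 := hX.connected.dist_triangle (u := v • o) (v := o) (w := u • o)
    have h4 := hG.dist_inv_smul hX.connected v (u • o) o
    have h5 := X.dist_comm (u := v • o) (v := o)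
    have h6 := hu.2
    rw [mul_smul, X.dist_comm, h4, X.dist_comm]
    omega
  refine (h1.union h2).subset ?_
  rintro u ⟨⟨ε, hε⟩, hM⟩
  rcases Int.units_eq_one_or ε with rfl | rfl
  · exact Or.inl ⟨hε, hM⟩
  · exact Or.inr ⟨hε, hM⟩

/-- In an acylindrical action on a tree, a hyperbolic element generates a subgroup of finite index
in its commensurator. -/
theorem TranslatesBy.relIndex_zpowers_ne_zero (hX : X.IsTree) (hG : ActsSimplicially G X)
    (hA : ActsAcylindrically G X) {t : G} {l : ℕ} (ht : TranslatesBy X t l) :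
    (Subgroup.zpowers t).relIndex (axisStabilizer t) ≠ 0 := by
  obtain ⟨o⟩ := hX.connected.nonempty
  obtain ⟨c, hc⟩ := ht.2 o
  have hfin := ht.finite_axisStabilizer hX hG hA o (c + l)
  have hfin' := hfin.to_subtype
  have hsurj : Function.Surjective
      (fun u : {u : G | u ∈ axisStabilizer t ∧ X.dist o (u • o) ≤ c + l} =>
        (QuotientGroup.mk ⟨u.1⁻¹, inv_mem u.2.1⟩ :
          axisStabilizer t ⧸ (Subgroup.zpowers t).subgroupOf (axisStabilizer t))) := by
    intro q
    induction q using QuotientGroup.induction_on with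
    | H g =>
      obtain ⟨ε, k, hk, hgk⟩ := g.2
      obtain ⟨n, hn⟩ := TranslatesBy.exists_dist_le hX hG (z := g.1⁻¹ • o) ht.1 hc hk
        (fun i hi => by
          rw [hG.dist_inv_smul hX.connected, smul_smul, smul_smul,
            CommensuratesWith.zpow_mul hgk, hc _ (by simp [hk, hi])]
          simp [Int.natAbs_mul])
      have hmem : t ^ n ∈ axisStabilizer t :=
        zpowers_le_axisStabilizer t (Subgroup.zpow_mem_zpowers t n)
      refine ⟨⟨(t ^ n)⁻¹ * g.1⁻¹, mul_mem (inv_mem hmem) (inv_mem g.2), ?_⟩, ?_⟩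
      · rw [mul_smul, X.dist_comm, hG.dist_inv_smul hX.connected]
        exact hn
      · rw [QuotientGroup.eq, Subgroup.mem_subgroupOf]
        simp only [Subgroup.coe_mul, Subgroup.coe_inv, mul_inv_rev, inv_inv]
        exact ⟨-n, by simp⟩
  have := Finite.of_surjective _ hsurj
  exact Subgroup.index_ne_zero_of_finite

/-- An infinite subgroup cannot centralise a hyperbolic element of which it contains no non-trivial
power. -/
lemma TranslatesBy.finite_of_commute (hX : X.IsTree) (hG : ActsSimplicially G X)
    (hA : ActsAcylindrically G X) {t : G} {l : ℕ} (ht : TranslatesBy X t l) {K : Subgroup G}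
    (hK : ∀ k ∈ K, Commute k t) (hKt : Disjoint (Subgroup.zpowers t) K) : Finite K := by
  have h1 : K ≤ axisStabilizer t := fun k hk => mem_axisStabilizer_of_commute (hK k hk)
  have h3 : (Subgroup.zpowers t).relIndex K ≠ 0 := fun h =>
    ht.relIndex_zpowers_ne_zero hX hG hA (Subgroup.relIndex_eq_zero_of_le_right h1 h)
  rw [← Subgroup.inf_relIndex_right, hKt.eq_bot, Subgroup.relIndex_bot_left] at h3
  exact Nat.finite_of_card_ne_zero h3

end Loxodromic

/-! ### Independent hyperbolic elements -/

section NonElementary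

variable {G T : Type*} [Group G] [MulAction G T] {X : SimpleGraph T}

/-- Hyperbolic elements `s`, `t` of equal translation length with the same attracting point stay
at bounded distance along their positive orbits. -/
lemma TranslatesBy.dist_pow_smul_le (hX : X.IsTree) {s t : G} {l cs ct : ℕ} {o : T}
    (hs : ∀ n : ℤ, n ≠ 0 → X.dist o (s ^ n • o) = n.natAbs * l + cs)
    (ht : ∀ n : ℤ, n ≠ 0 → X.dist o (t ^ n • o) = n.natAbs * l + ct)
    (hG : ActsSimplicially G X) (hst : SameAttractingPoint X o s t) (n : ℕ) :
    X.dist (s ^ n • o) (t ^ n • o) ≤ cs + ct := by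
  rcases Nat.eq_zero_or_pos n with rfl | hn
  · simp
  obtain ⟨⟨a, b⟩, hab⟩ := Filter.eventually_atTop.1 (Filter.tendsto_atTop.1 hst (n * l : ℕ))
  obtain ⟨m, hma, hmb, hmn⟩ : ∃ m, a ≤ m ∧ b ≤ m ∧ n < m :=
    ⟨a + b + n + 1, by omega, by omega, by omega⟩
  have h1 := hab (m, m) ⟨hma, hmb⟩
  simp only [gromovProd] at h1
  have h2 : X.dist (s ^ m • o) (t ^ m • o) + 2 * (n * l) ≤
      X.dist o (s ^ m • o) + X.dist o (t ^ m • o) := by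
    have : (X.dist (s ^ m • o) (t ^ m • o) : ℝ) + 2 * (n * l : ℕ) ≤
      X.dist o (s ^ m • o) + X.dist o (t ^ m • o) := by linarith
    exact_mod_cast this
  have hpos : ∀ (u : G) (c : ℕ), (∀ n : ℤ, n ≠ 0 → X.dist o (u ^ n • o) = n.natAbs * l + c) →
      X.dist o (u ^ n • o) = n * l + c ∧ X.dist o (u ^ m • o) = m * l + c ∧
      X.dist (u ^ n • o) (u ^ m • o) + n * l = m * l + c := by
    intro u c hu
    have e1 := hu n (by omega)
    have e2 := hu m (by omega)
    have e3 := hu ((m : ℤ) - n) (by omega)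
    rw [← hG.dist_zpow_smul hX.connected] at e3
    simp only [zpow_natCast, Int.natAbs_natCast] at e1 e2 e3
    refine ⟨e1, e2, ?_⟩
    rw [e3, show ((m : ℤ) - n).natAbs = m - n by omega]
    have : (m - n) * l + n * l = m * l := by rw [← Nat.add_mul]; congr 1; omega
    omega
  obtain ⟨s1, s2, s3⟩ := hpos s cs hs
  obtain ⟨t1, t2, t3⟩ := hpos t ct ht
  generalize s ^ n • o = p at *
  generalize t ^ n • o = q at *
  generalize s ^ m • o = P at *
  generalize t ^ m • o = Q at *
  have hle : n * l ≤ m * l := Nat.mul_le_mul_right _ hmn.le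
  generalize n * l = A at *
  generalize m * l = B at *
  have c1 := X.dist_comm (u := p) (v := o)
  have c2 := X.dist_comm (u := q) (v := o)
  have c3 := X.dist_comm (u := Q) (v := o)
  have c4 := X.dist_comm (u := Q) (v := P)
  have hpQ : X.dist p Q + A ≤ B + cs + ct := by
    have := hX.four_point p Q o P
    omega
  have := hX.four_point p q o Q
  omega

/-- In an acylindrical action on a tree, hyperbolic elements of equal translation length with the
same attracting point have a common power. -/
lemma TranslatesBy.exists_pow_eq (hX : X.IsTree) (hG : ActsSimplicially G X)
    (hA : ActsAcylindrically G X) {s t : G} {l : ℕ} {o : T} (hs : TranslatesBy X s l)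
    (ht : TranslatesBy X t l) (hst : SameAttractingPoint X o s t) :
    ∃ k : ℕ, 0 < k ∧ s ^ k = t ^ k := by
  obtain ⟨cs, hcs⟩ := hs.2 o
  obtain ⟨ct, hct⟩ := ht.2 o
  have hle := TranslatesBy.dist_pow_smul_le hX hcs hct hG hst
  -- all `t ^ (-n) * s ^ n` move both `o` and the distant vertex `s ^ (R + 1) • o` by a bounded amount
  obtain ⟨R, hR⟩ := hA.exists_finite (2 * (cs + ct))
  have h1 : R ≤ X.dist o (s ^ (R + 1) • o) := by
    have := hcs ((R + 1 : ℕ) : ℤ) (by omega)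
    rw [zpow_natCast, Int.natAbs_natCast] at this
    rw [this]
    have := hs.1
    nlinarith
  have hfin := hR _ _ h1
  have hmem : ∀ n : ℕ, (t ^ n)⁻¹ * s ^ n ∈ {g : G | X.dist o (g • o) ≤ 2 * (cs + ct) ∧
      X.dist (s ^ (R + 1) • o) (g • s ^ (R + 1) • o) ≤ 2 * (cs + ct)} := by
    intro n
    refine ⟨?_, ?_⟩
    · have := hle n
      rw [mul_smul, X.dist_comm, hG.dist_inv_smul hX.connected]
      omega
    · have e1 := hle (R + 1)
      have e2 := hle (n + (R + 1))
      have e3 := hX.connected.dist_triangle (u := s ^ (R + 1) • o) (v := t ^ (R + 1) • o)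
        (w := ((t ^ n)⁻¹ * s ^ n) • s ^ (R + 1) • o)
      rw [pow_add s n, pow_add t n, mul_smul, mul_smul] at e2
      rw [mul_smul] at e3 ⊢
      rw [X.dist_comm (u := t ^ (R + 1) • o), hG.dist_inv_smul hX.connected] at e3
      omega
  have hninj : ¬ Function.Injective fun n : ℕ => (t ^ n)⁻¹ * s ^ n := fun hinj =>
    Set.infinite_range_of_injective hinj (hfin.subset (Set.range_subset_iff.2 hmem))
  have hex : ∃ m n : ℕ, m < n ∧ (t ^ m)⁻¹ * s ^ m = (t ^ n)⁻¹ * s ^ n := by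
    simp only [Function.Injective, not_forall] at hninj
    obtain ⟨m, n, h, hne⟩ := hninj
    rcases lt_or_gt_of_ne hne with h' | h'
    · exact ⟨m, n, h', h⟩
    · exact ⟨n, m, h', h.symm⟩
  obtain ⟨m, n, hmn, h⟩ := hex
  refine ⟨n - m, by omega, ?_⟩
  obtain ⟨k, rfl⟩ := Nat.exists_eq_add_of_lt hmn
  rw [show m + k + 1 - m = k + 1 by omega]
  rw [show m + k + 1 = (k + 1) + m by omega, pow_add, pow_add, mul_inv_rev] at h
  have h2 : (t ^ m)⁻¹ * 1 * s ^ m = (t ^ m)⁻¹ * ((t ^ (k + 1))⁻¹ * s ^ (k + 1)) * s ^ m := by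
    rw [mul_one, h]
    group
  exact (inv_mul_eq_one.1 (mul_left_cancel (mul_right_cancel h2)).symm).symm

/-- Non-independent conjugates of a hyperbolic element differ by an element of the stabiliser of its
axis. -/
lemma TranslatesBy.mem_axisStabilizer (hX : X.IsTree) (hG : ActsSimplicially G X)
    (hA : ActsAcylindrically G X) {t g h : G} {l : ℕ} {o : T} (ht : TranslatesBy X t l)
    {ε δ : ℤˣ}
    (hst : SameAttractingPoint X o ((g * t * g⁻¹) ^ (ε : ℤ)) ((h * t * h⁻¹) ^ (δ : ℤ))) :
    g⁻¹ * h ∈ axisStabilizer t := by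
  have hpow : ∀ (u : G) (ε : ℤˣ), TranslatesBy X ((u * t * u⁻¹) ^ (ε : ℤ)) l := by
    intro u ε
    rcases Int.units_eq_one_or ε with rfl | rfl
    · simpa using ht.conj hX hG u
    · simpa using (ht.conj hX hG u).inv
  obtain ⟨k, hk, hkst⟩ := (hpow g ε).exists_pow_eq hX hG hA (hpow h δ) hst
  refine ⟨ε * δ, δ * k, by simpa using hk.ne', ?_⟩
  simp only [← zpow_natCast, ← zpow_mul, conj_zpow] at hkst
  have hδ : ((δ : ℤ) * δ) = 1 := by
    rw [← Units.val_mul, Int.units_mul_self, Units.val_one]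
  calc g⁻¹ * h * t ^ ((δ : ℤ) * k) * (g⁻¹ * h)⁻¹ = g⁻¹ * (h * t ^ ((δ : ℤ) * k) * h⁻¹) * g := by
        group
    _ = t ^ ((ε : ℤ) * k) := by rw [← hkst]; group
    _ = _ := by
      congr 1
      push_cast
      linear_combination -(ε * k : ℤ) * hδ

/-- An acylindrical action on a tree with a hyperbolic element is non-elementary, unless the group
is virtually cyclic: the conjugates of the hyperbolic element have infinitely many axes. -/
theorem ActsAcylindrically.actsNonElementarily (hX : X.IsTree) (hG : ActsSimplicially G X)
    (hA : ActsAcylindrically G X) {t : G} (ht : ∀ x : T, t • x ≠ x)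
    (hvc : ¬ IsVirtuallyCyclic G) : ActsNonElementarily G X := by
  obtain ⟨l, ht⟩ := hG.exists_translatesBy hX ht
  have hinf : Infinite (G ⧸ axisStabilizer t) := by
    by_contra hfin
    rw [not_infinite_iff_finite] at hfin
    refine hvc ⟨Subgroup.zpowers t, inferInstance, ⟨?_⟩⟩
    rw [← Subgroup.relIndex_mul_index (zpowers_le_axisStabilizer t)]
    exact mul_ne_zero (ht.relIndex_zpowers_ne_zero hX hG hA) Subgroup.index_ne_zero_of_finite
  have heq : ∀ q q' : G ⧸ axisStabilizer t, q.out⁻¹ * q'.out ∈ axisStabilizer t → q = q' :=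
    fun q q' h => by rw [← q.out_eq', ← q'.out_eq']; exact QuotientGroup.eq.2 h
  have hcomm : ∀ a b : G, a * t * a⁻¹ = b * t * b⁻¹ → Commute (a⁻¹ * b) t := fun a b h => by
    calc a⁻¹ * b * t = a⁻¹ * (b * t * b⁻¹) * b := by group
      _ = t * (a⁻¹ * b) := by rw [← h]; group
  refine ⟨Set.range fun q : G ⧸ axisStabilizer t => q.out * t * q.out⁻¹,
    Set.infinite_range_of_injective fun q q' h => heq q q' ?_, ?_, ?_⟩
  · apply mem_axisStabilizer_of_commute
    exact hcomm _ _ h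
  · rintro _ ⟨q, rfl⟩
    exact (ht.conj hX hG _).isLoxodromic hX hG
  · rintro _ ⟨q, rfl⟩ _ ⟨q', rfl⟩ hne o
    have hq : q.out⁻¹ * q'.out ∉ axisStabilizer t := fun h => hne (by rw [heq q q' h])
    have key : ∀ ε δ : ℤˣ, ¬ SameAttractingPoint X o ((q.out * t * q.out⁻¹) ^ (ε : ℤ))
        ((q'.out * t * q'.out⁻¹) ^ (δ : ℤ)) := fun ε δ h =>
      hq (ht.mem_axisStabilizer hX hG hA h)
    have h1 := key 1 1
    have h2 := key 1 (-1)
    have h3 := key (-1) 1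
    have h4 := key (-1) (-1)
    simp only [Units.val_one, Units.val_neg, zpow_one, zpow_neg] at h1 h2 h3 h4
    exact ⟨h1, h2, h3, h4⟩

/-- Hyperbolic elements with a common positive power have the same attracting point. -/
lemma TranslatesBy.sameAttractingPoint (hX : X.IsTree) (hG : ActsSimplicially G X) {g h : G}
    {l l' : ℕ} (hg : TranslatesBy X g l) (hh : TranslatesBy X h l') {a b : ℕ} (ha : 0 < a)
    (hb : 0 < b) (hab : g ^ a = h ^ b) (o : T) : SameAttractingPoint X o g h := by
  have key : ∀ (u : G) (l a p i : ℕ), TranslatesBy X u l → 0 < a → p < i →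
      X.dist (u ^ p • o) (u ^ (a * i) • o) + 2 * p ≤
        X.dist o (u ^ p • o) + X.dist o (u ^ (a * i) • o) := by
    intro u l a p i hu ha hpi
    rcases Nat.eq_zero_or_pos p with rfl | hp
    · simp
    obtain ⟨c, hc⟩ := hu.2 o
    have hai : p < a * i := by nlinarith
    have e1 := hc p (by omega)
    have e2 := hc (a * i : ℕ) (by omega)
    have e3 := hc ((a * i : ℕ) - (p : ℤ)) (by omega)
    rw [← hG.dist_zpow_smul hX.connected] at e3
    simp only [zpow_natCast, Int.natAbs_natCast] at e1 e2 e3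
    rw [e1, e2, e3, show (((a * i : ℕ) : ℤ) - p).natAbs = a * i - p by omega]
    have h1 : (a * i - p) * l + p * l = a * i * l := by rw [← Nat.add_mul]; congr 1; omega
    have h2 : p * 1 ≤ p * l := Nat.mul_le_mul_left _ hu.1
    omega
  refine Filter.tendsto_atTop.2 fun B => ?_
  filter_upwards [Filter.eventually_ge_atTop (⌈B⌉₊, ⌈B⌉₊)] with ⟨p, q⟩ hpq
  obtain ⟨hp, hq⟩ : ⌈B⌉₊ ≤ p ∧ ⌈B⌉₊ ≤ q := hpq
  have h1 := key g l a p (p + q + 1) hg ha (by omega)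
  have h2 := key h l' b q (p + q + 1) hh hb (by omega)
  rw [pow_mul, hab] at h1
  rw [pow_mul] at h2
  have h3 : X.dist (g ^ p • o) (h ^ q • o) + 2 * ⌈B⌉₊ ≤
      X.dist o (g ^ p • o) + X.dist o (h ^ q • o) := by
    generalize (h ^ b) ^ (p + q + 1) • o = w at *
    have c1 := X.dist_comm (u := g ^ p • o) (v := o)
    have c2 := X.dist_comm (u := h ^ q • o) (v := o)
    have c3 := X.dist_comm (u := h ^ q • o) (v := w)
    have := hX.four_point (g ^ p • o) (h ^ q • o) o w
    omega
  have h4 : (X.dist (g ^ p • o) (h ^ q • o) : ℝ) + 2 * (⌈B⌉₊ : ℝ) ≤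
      X.dist o (g ^ p • o) + X.dist o (h ^ q • o) := by exact_mod_cast h3
  have h5 := Nat.le_ceil B
  simp only [gromovProd]
  linarith

/-- A virtually cyclic group has no non-elementary action on a tree. -/
theorem ActsNonElementarily.not_isVirtuallyCyclic (hX : X.IsTree) (hG : ActsSimplicially G X)
    (hne : ActsNonElementarily G X) : ¬ IsVirtuallyCyclic G := by
  rintro ⟨H, hcyc, hfin⟩
  obtain ⟨S, hS, hlox, hind⟩ := hne
  obtain ⟨g, hg, h, hh, hgh⟩ := hS.nontrivial
  obtain ⟨o⟩ := hX.connected.nonempty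
  obtain ⟨l, hgl⟩ := (hlox g hg).exists_translatesBy hX hG
  obtain ⟨l', hhl⟩ := (hlox h hh).exists_translatesBy hX hG
  obtain ⟨z, hz⟩ := hcyc.exists_generator
  have hex : ∀ (u : G) (l : ℕ), TranslatesBy X u l →
      ∃ n i : ℤ, n ≠ 0 ∧ i ≠ 0 ∧ u ^ n = (z : G) ^ i := by
    intro u l hu
    obtain ⟨n, hn, -, hnH⟩ := Subgroup.exists_pow_mem_of_index_ne_zero hfin.index_ne_zero u
    obtain ⟨i, hi⟩ := hz ⟨u ^ n, hnH⟩
    have hi' : (z : G) ^ i = u ^ n := by simpa using congrArg Subtype.val hi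
    refine ⟨n, i, by omega, ?_, by rw [hi', zpow_natCast]⟩
    rintro rfl
    refine hu.zpow_ne_one hX (n := n) (by omega) ?_
    rw [zpow_natCast, ← hi', zpow_zero]
  obtain ⟨n, i, hn, hi, hni⟩ := hex g l hgl
  obtain ⟨m, j, hm, hj, hmj⟩ := hex h l' hhl
  have hcom : g ^ (n * j) = h ^ (m * i) := by
    rw [zpow_mul, hni, ← zpow_mul, mul_comm i, zpow_mul, ← hmj, ← zpow_mul]
  have ha : n * j ≠ 0 := mul_ne_zero hn hj
  have hb : m * i ≠ 0 := mul_ne_zero hm hi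
  generalize n * j = a at *
  generalize m * i = b at *
  obtain ⟨h1, h2, h3, h4⟩ := hind hg hh hgh o
  have ha' : 0 < a.natAbs := by omega
  have hb' : 0 < b.natAbs := by omega
  rcases Int.natAbs_eq a with ea | ea <;> rcases Int.natAbs_eq b with eb | eb <;>
    rw [ea, eb] at hcom
  · exact h1 (hgl.sameAttractingPoint hX hG hhl ha' hb' (by simpa only [zpow_neg, zpow_natCast, inv_pow] using hcom) o)
  · exact h2 (hgl.sameAttractingPoint hX hG hhl.inv ha' hb' (by simpa only [zpow_neg, zpow_natCast, inv_pow] using hcom) o)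
  · exact h3 (hgl.inv.sameAttractingPoint hX hG hhl ha' hb' (by simpa only [zpow_neg, zpow_natCast, inv_pow] using hcom) o)
  · exact h4 (hgl.inv.sameAttractingPoint hX hG hhl.inv ha' hb' (by simpa only [zpow_neg, zpow_natCast, inv_pow] using hcom) o)

end NonElementary

/-! ### Acylindricity from stabilisers of long geodesics -/

lemma Set.encard_le_card_mul_of_fibers {α β : Type*} (f : α → β) (F : Finset β)
    (C : ℕ) (S : Set α) (hf : ∀ a ∈ S, f a ∈ F)
    (hC : ∀ a ∈ S, {b ∈ S | f b = f a}.encard ≤ C) : S.encard ≤ (F.card * C : ℕ) := by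
  have h1 : S ⊆ ⋃ b ∈ F, {a ∈ S | f a = b} := fun a ha =>
    Set.mem_biUnion (hf a ha) ⟨ha, rfl⟩
  have h2 : ∀ b ∈ F, {a ∈ S | f a = b}.encard ≤ C := fun b _ => by
    rcases Set.eq_empty_or_nonempty {a ∈ S | f a = b} with h | ⟨a, ha, rfl⟩
    · simp [h]
    · exact hC a ha
  calc S.encard ≤ _ := Set.encard_le_encard h1
    _ ≤ ∑ b ∈ F, {a ∈ S | f a = b}.encard := F.set_encard_biUnion_le _
    _ ≤ F.card • (C : ℕ∞) := Finset.sum_le_card_nsmul _ _ _ h2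
    _ = _ := by simp

section Acylindricity

variable {G T : Type*} [Group G] [MulAction G T] {X : SimpleGraph T}

/-- If `g` moves `x` and `y` by at most `E`, then it maps every vertex of the geodesic from `x` to
`y` which is at distance at least `E` from its endpoints to a vertex of this geodesic. -/
lemma ActsSimplicially.between_smul (hX : X.IsTree) (hG : ActsSimplicially G X) {g : G} {x y m : T}
    {E : ℕ} (hx : X.dist x (g • x) ≤ E) (hy : X.dist y (g • y) ≤ E)
    (hm : X.dist x m + X.dist m y = X.dist x y) (hxm : E ≤ X.dist x m) (hmy : E < X.dist m y) :
    X.dist x (g • m) + X.dist (g • m) y = X.dist x y := by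
  have h1 := hG.dist_smul hX.connected g x m
  have h2 := hG.dist_smul hX.connected g m y
  have h3 := hG.dist_smul hX.connected g x y
  generalize g • x = x' at *
  generalize g • y = y' at *
  generalize g • m = m' at *
  have c1 := X.dist_comm (u := m') (v := x')
  have c2 := X.dist_comm (u := m') (v := y)
  have c3 := X.dist_comm (u := x') (v := y)
  have h4 := hX.four_point x m' x' y'
  have h5 := hX.four_point y m' x' y'
  have h6 := hX.four_point x y' y x'
  have h7 := hX.connected.dist_triangle (u := x) (v := m') (w := y)
  have h8 : X.dist x m' = 0 → x = m' := hX.connected.dist_eq_zero_iff.1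
  by_cases h9 : X.dist x m' = 0
  · rw [← h8 h9, SimpleGraph.dist_self, zero_add]
  · clear h8
    have c4 := X.dist_comm (u := y') (v := x')
    have c5 := X.dist_comm (u := y') (v := y)
    omega

/-- An action on a tree is acylindrical if the pointwise stabilisers of all long geodesics have
uniformly bounded order: an element moving the ends of a very long geodesic by a bounded amount
shifts its middle part along it, and there are boundedly many shifts. -/
theorem ActsSimplicially.actsAcylindrically (hX : X.IsTree) (hG : ActsSimplicially G X) (k C : ℕ)
    (h : ∀ x y : T, k ≤ X.dist x y → {g : G | g • x = x ∧ g • y = y}.encard ≤ C) :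
    ActsAcylindrically G X := by
  intro ε hε
  set E := ⌈ε⌉₊ with hE
  refine ⟨2 * E + k + 1,
    (Finset.range (2 * E + 1) ×ˢ Finset.range (2 * E + k + 1)).card * C, fun x y hxy => ?_⟩
  obtain ⟨p, hp1, hp2⟩ := hX.connected.exists_dist_eq (x := x) (y := y) (k := E) (by omega)
  obtain ⟨q, hq1, hq2⟩ := hX.connected.exists_dist_eq (x := x) (y := y) (k := E + k) (by omega)
  have hpq : k ≤ X.dist p q := by
    have := hX.connected.dist_triangle (u := x) (v := p) (w := q)
    omega
  have hmem : ∀ g ∈ pqStab G X ε x y, X.dist x (g • x) ≤ E ∧ X.dist y (g • y) ≤ E := by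
    intro g hg
    have h1 := hg.1.trans (Nat.le_ceil ε)
    have h2 := hg.2.trans (Nat.le_ceil ε)
    exact ⟨by exact_mod_cast h1, by exact_mod_cast h2⟩
  have hle : ∀ g ∈ pqStab G X ε x y, ∀ m, X.dist x (g • m) ≤ E + X.dist x m := by
    intro g hg m
    have h1 := hX.connected.dist_triangle (u := x) (v := g • x) (w := g • m)
    have h2 := hG.dist_smul hX.connected g x m
    have h3 := hmem g hg
    omega
  refine Set.encard_le_card_mul_of_fibers (fun g : G => (X.dist x (g • p), X.dist x (g • q)))
    (Finset.range (2 * E + 1) ×ˢ Finset.range (2 * E + k + 1)) C _ (fun g hg => ?_)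
    (fun g hg => ?_)
  · have h1 := hle g hg p
    have h2 := hle g hg q
    simp only [Finset.mem_product, Finset.mem_range]
    omega
  · refine le_trans ?_ (h p q hpq)
    rw [← (mul_right_injective g⁻¹).encard_image]
    refine Set.encard_le_encard ?_
    rintro _ ⟨g', ⟨hg', heq⟩, rfl⟩
    have hb := hmem g hg
    have hb' := hmem g' hg'
    obtain ⟨e1, e2⟩ := Prod.ext_iff.1 heq
    have h1 : g' • p = g • p := hX.eq_of_between
      (hG.between_smul hX hb'.1 hb'.2 hp2 (by omega) (by omega))
      (hG.between_smul hX hb.1 hb.2 hp2 (by omega) (by omega)) e1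
    have h2 : g' • q = g • q := hX.eq_of_between
      (hG.between_smul hX hb'.1 hb'.2 hq2 (by omega) (by omega))
      (hG.between_smul hX hb.1 hb.2 hq2 (by omega) (by omega)) e2
    constructor
    · rw [mul_smul, h1, inv_smul_smul]
    · rw [mul_smul, h2, inv_smul_smul]

end Acylindricity

/-! ### Automorphisms of free products permuting the letters of reduced words -/

namespace Monoid.CoprodI.Word

variable {ι : Type*} {M : ι → Type*} [∀ i, Monoid (M i)]

lemma prod_injective : Function.Injective (prod : Word M → CoprodI M) := by
  classical exact (equiv (M := M)).symm.injective

lemma exists_prod_eq (x : CoprodI M) : ∃ w : Word M, w.prod = x := by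
  classical exact (equiv (M := M)).symm.surjective x

/-- Applying to every letter of a reduced word an injective homomorphism to another factor. -/
@[simps]
def mapLetters (σ : ι → ι) (hσ : Function.Injective σ) (θ : ∀ i, M i →* M (σ i))
    (hθ : ∀ i, Function.Injective (θ i)) (w : Word M) : Word M where
  toList := w.toList.map fun l => ⟨σ l.1, θ l.1 l.2⟩
  ne_one := by
    intro l' hl'
    obtain ⟨l, hl, rfl⟩ := List.mem_map.1 hl'
    exact (map_ne_one_iff _ (hθ _)).2 (w.ne_one l hl)
  chain_ne := by
    rw [List.isChain_map]
    exact w.chain_ne.imp fun a b h => hσ.ne h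

lemma prod_mapLetters {σ : ι → ι} {hσ : Function.Injective σ} {θ : ∀ i, M i →* M (σ i)}
    {hθ : ∀ i, Function.Injective (θ i)} (w : Word M) :
    (w.mapLetters σ hσ θ hθ).prod = lift (fun i => of.comp (θ i)) w.prod := by
  simp only [prod, mapLetters_toList, map_list_prod, List.map_map]
  congr 1

/-- An endomorphism of a free product which permutes the factors and fixes an element fixes all
letters of its normal form. -/
lemma eq_of_lift_prod_eq {σ : ι → ι} (hσ : Function.Injective σ) {θ : ∀ i, M i →* M (σ i)}
    (hθ : ∀ i, Function.Injective (θ i)) {w : Word M}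
    (h : lift (fun i => of.comp (θ i)) w.prod = w.prod) {l : Σ i, M i} (hl : l ∈ w.toList) :
    (⟨σ l.1, θ l.1 l.2⟩ : Σ i, M i) = l := by
  rw [← prod_mapLetters (hσ := hσ) (hθ := hθ)] at h
  have h1 := congrArg toList (prod_injective h)
  rw [mapLetters_toList] at h1
  exact List.map_inj_left.1 (h1.trans (List.map_id _).symm) l hl

end Monoid.CoprodI.Word

/-! ### The Bass–Serre tree of a free product -/

namespace FreeProductTree

open Monoid

variable {ι : Type*} (A : ι → Type*) [∀ i, Group (A i)]

/-- The vertices of the Bass–Serre tree of the free product of the groups `A i`: the elements of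
the free product, and the left cosets of the factors. -/
abbrev Vertex : Type _ := CoprodI A ⊕ Σ i, CoprodI A ⧸ (CoprodI.of : A i →* CoprodI A).range

/-- Each element of the free product is joined to its left cosets. -/
def graph : SimpleGraph (Vertex A) where
  Adj u v := (∃ x i, u = .inl x ∧ v = .inr ⟨i, x⟩) ∨ ∃ x i, v = .inl x ∧ u = .inr ⟨i, x⟩
  symm := ⟨fun _ _ h => h.symm⟩
  loopless := ⟨by
    rintro v (⟨x, i, h, h'⟩ | ⟨x, i, h, h'⟩) <;> rw [h] at h' <;> cases h'⟩

variable {A}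

lemma adj_inl_inr (x : CoprodI A) (i : ι) : (graph A).Adj (.inl x) (.inr ⟨i, x⟩) :=
  Or.inl ⟨x, i, rfl, rfl⟩

lemma mk_mul_of (x : CoprodI A) {i : ι} (m : A i) :
    ((x * CoprodI.of m : CoprodI A) :
      CoprodI A ⧸ (CoprodI.of : A i →* CoprodI A).range) = x :=
  QuotientGroup.mk_mul_of_mem _ ⟨m, rfl⟩

lemma reachable_mul (x y : CoprodI A) : (graph A).Reachable (.inl y) (.inl (y * x)) := by
  induction x using CoprodI.induction_on generalizing y with
  | one => rw [mul_one]
  | of i m =>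
    refine (adj_inl_inr y i).reachable.trans ?_
    have := (adj_inl_inr (y * CoprodI.of m) i).symm.reachable
    rwa [mk_mul_of] at this
  | mul x z hx hz =>
    rw [← mul_assoc]
    exact (hx y).trans (hz _)

lemma connected : (graph A).Connected := by
  have h : ∀ v, (graph A).Reachable (.inl 1) v := by
    rintro (x | ⟨i, q⟩)
    · simpa using reachable_mul x 1
    · induction q using QuotientGroup.induction_on with
      | H x =>
        have hx : (graph A).Reachable (.inl 1) (.inl x) := by simpa using reachable_mul x 1
        exact hx.trans (adj_inl_inr x i).reachable
  exact ⟨fun u v => (h u).symm.trans (h v)⟩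

lemma dist_mul_prod_le (w : CoprodI.Word A) (x : CoprodI A) :
    (graph A).dist (.inl x) (.inl (x * w.prod)) ≤ 2 * w.toList.length := by
  induction w using CoprodI.Word.consRecOn generalizing x with
  | empty => simp
  | cons i m w h1 h2 ih =>
    have h3 := ih (x * CoprodI.of m)
    have e1 := SimpleGraph.dist_eq_one_iff_adj.2 (adj_inl_inr x i)
    have e2 := SimpleGraph.dist_eq_one_iff_adj.2 (adj_inl_inr (x * CoprodI.of m) i).symm
    rw [mk_mul_of] at e2
    have e3 := connected.dist_triangle (u := (.inl x : Vertex A)) (v := .inr ⟨i, x⟩)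
      (w := .inl (x * CoprodI.of m))
    have e4 := connected.dist_triangle (u := (.inl x : Vertex A)) (v := .inl (x * CoprodI.of m))
      (w := .inl (x * CoprodI.of m * w.prod))
    rw [CoprodI.Word.prod_cons, ← mul_assoc]
    simp only [CoprodI.Word.cons_toList, List.length_cons]
    omega

section Height

open scoped Classical in
/-- The normal form of `x⁻¹`. Inverses are taken as normal forms are decomposed from the left,
whereas the vertices are left cosets. -/
noncomputable def invWord (x : CoprodI A) : CoprodI.Word A := CoprodI.Word.equiv x⁻¹

open scoped Classical in
/-- The normal form of `x⁻¹` without its initial letter if this lies in `A i`. -/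
noncomputable def invTail (i : ι) (x : CoprodI A) : CoprodI.Word A :=
  (CoprodI.Word.equivPair i (invWord x)).tail

lemma invWord_injective : Function.Injective (invWord : CoprodI A → CoprodI.Word A) := by
  classical
  intro x y h
  exact inv_injective (CoprodI.Word.equiv.injective h)

lemma invTail_mul_of (i : ι) (x : CoprodI A) (m : A i) :
    invTail i (x * CoprodI.of m) = invTail i x := by
  classical
  have h : invWord (x * CoprodI.of m) = CoprodI.of m⁻¹ • invWord x := by
    simp only [invWord, mul_inv_rev, map_inv]
    exact mul_smul (CoprodI.of m)⁻¹ x⁻¹ (CoprodI.Word.empty : CoprodI.Word A)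
  rw [invTail, h, CoprodI.Word.equivPair_smul_same]
  rfl

lemma invTail_congr {i : ι} {x y : CoprodI A}
    (h : (x : CoprodI A ⧸ (CoprodI.of : A i →* CoprodI A).range) = y) :
    invTail i x = invTail i y := by
  obtain ⟨m, hm⟩ := QuotientGroup.eq.1 h
  rw [← mul_inv_cancel_left x y, ← hm, invTail_mul_of]

lemma invWord_cases (i : ι) (x : CoprodI A) :
    (invWord x = invTail i x) ∨ ((invWord x).fstIdx = some i ∧
      (invWord x).toList.length = (invTail i x).toList.length + 1) := by
  classical
  set p := CoprodI.Word.equivPair i (invWord x) with hp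
  have h : invWord x = CoprodI.Word.rcons p := by
    rw [← CoprodI.Word.equivPair_symm, hp, Equiv.symm_apply_apply]
  have ht : invTail i x = p.tail := rfl
  rw [ht, h, CoprodI.Word.rcons]
  split_ifs with h1
  · exact Or.inl rfl
  · exact Or.inr ⟨CoprodI.Word.fstIdx_cons _ _ _ _, rfl⟩

/-- Twice the length of the normal form for elements, and one more than the minimum of this over
its elements for cosets. -/
noncomputable def height : Vertex A → ℕ
  | .inl x => 2 * (invWord x).toList.length
  | .inr ⟨i, q⟩ => 2 * (invTail i q.out).toList.length + 1

lemma height_inr (i : ι) (x : CoprodI A) :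
    height (.inr ⟨i, x⟩ : Vertex A) = 2 * (invTail i x).toList.length + 1 := by
  rw [height, invTail_congr (Quotient.out_eq' _)]

lemma isTree : (graph A).IsTree := by
  refine ⟨connected, SimpleGraph.isAcyclic_of_height height ?_ ?_⟩
  · rintro u v (⟨x, i, rfl, rfl⟩ | ⟨x, i, rfl, rfl⟩) <;> rw [height_inr, height] <;> omega
  · rintro u v w (⟨x, i, rfl, rfl⟩ | ⟨x, i, rfl, rfl⟩) (⟨y, j, hy, rfl⟩ | ⟨y, j, rfl, hy⟩) hv hw
    · obtain rfl : x = y := Sum.inl_injective hy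
      rw [height_inr, height] at hv hw
      rcases invWord_cases i x with h1 | ⟨h1, -⟩
      · rw [h1] at hv; omega
      rcases invWord_cases j x with h2 | ⟨h2, -⟩
      · rw [h2] at hw; omega
      obtain rfl : i = j := Option.some_injective _ (h1.symm.trans h2)
      rfl
    · cases hy
    · cases hy
    · obtain ⟨rfl, hxy⟩ := Sigma.mk.inj_iff.1 (Sum.inr_injective hy)
      rw [heq_eq_eq] at hxy
      have hv' := hv
      rw [height_inr, height] at hv
      rw [hxy, height_inr, height] at hw
      rcases invWord_cases i x with h1 | ⟨-, h1⟩
      · rcases invWord_cases i y with h2 | ⟨-, h2⟩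
        · rw [invWord_injective (h1.trans ((invTail_congr hxy).trans h2.symm))]
        · omega
      · omega

end Height

end FreeProductTree

/-! ### Automorphisms acting on the Bass–Serre tree of a free product -/

/-- A group acting on `N` by endomorphisms acts by automorphisms. -/
def MulAut.ofEndHom {P N : Type*} [Group P] [Monoid N] (f : P →* Monoid.End N) :
    P →* MulAut N where
  toFun p := MonoidHom.toMulEquiv (f p) (f p⁻¹)
    (by change f p⁻¹ * f p = 1; rw [← map_mul, inv_mul_cancel, map_one])
    (by change f p * f p⁻¹ = 1; rw [← map_mul, mul_inv_cancel, map_one])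
  map_one' := by
    ext x
    change f 1 x = x
    rw [map_one]
    rfl
  map_mul' p q := by
    ext x
    change f (p * q) x = f p (f q x)
    rw [map_mul]
    rfl

namespace FreeProductTree

open Monoid

variable {ι : Type*} {A : ι → Type*} [∀ i, Group (A i)] {P : Type*} [Group P]

/-- The action of `P` on the free product induced by actions on the factors. -/
def factorAut (φ : ∀ i, P →* MulAut (A i)) : P →* MulAut (CoprodI A) :=
  MulAut.ofEndHom
    { toFun := fun p => CoprodI.lift fun i => CoprodI.of.comp (φ i p).toMonoidHom
      map_one' := by
        change CoprodI.lift _ = MonoidHom.id (CoprodI A)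
        refine CoprodI.ext_hom _ _ fun i => ?_
        ext m
        simp
      map_mul' := fun p q => by
        change _ = (CoprodI.lift fun i => CoprodI.of.comp (φ i p).toMonoidHom).comp
          (CoprodI.lift fun i => CoprodI.of.comp (φ i q).toMonoidHom)
        refine CoprodI.ext_hom _ _ fun i => ?_
        ext m
        simp }

lemma factorAut_apply (φ : ∀ i, P →* MulAut (A i)) (p : P) (x : CoprodI A) :
    factorAut φ p x = CoprodI.lift (fun i => CoprodI.of.comp (φ i p).toMonoidHom) x := rfl

@[simp]
lemma factorAut_of (φ : ∀ i, P →* MulAut (A i)) (p : P) {i : ι} (m : A i) :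
    factorAut φ p (CoprodI.of m) = CoprodI.of (φ i p m) := by
  simp [factorAut_apply]

variable {φ : ∀ i, P →* MulAut (A i)}

/-- The semidirect product of the free product with `P` acts on the Bass–Serre tree: the free
product by left multiplication and `P` by automorphisms. -/
instance : MulAction (CoprodI A ⋊[factorAut φ] P) (Vertex A) where
  smul d v := match v with
    | .inl x => .inl (d.left * factorAut φ d.right x)
    | .inr ⟨i, q⟩ => .inr ⟨i, Quotient.map' (fun x => d.left * factorAut φ d.right x)
        (fun x y hxy => by
          rw [QuotientGroup.leftRel_apply] at hxy ⊢
          obtain ⟨m, hm⟩ := hxy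
          refine ⟨φ i d.right m, ?_⟩
          rw [← factorAut_of, hm, map_mul, map_inv]
          group) q⟩
  one_smul v := by
    rcases v with x | ⟨i, q⟩
    · change Sum.inl _ = _
      simp
    · induction q using QuotientGroup.induction_on with
      | H x =>
        change (Sum.inr ⟨i, ((_ : CoprodI A) : CoprodI A ⧸ _)⟩ : Vertex A) = _
        simp
  mul_smul d e v := by
    rcases v with x | ⟨i, q⟩
    · change Sum.inl _ = Sum.inl _
      simp [mul_assoc]
    · induction q using QuotientGroup.induction_on with
      | H x =>
        change (Sum.inr ⟨i, ((_ : CoprodI A) : CoprodI A ⧸ _)⟩ : Vertex A) =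
          Sum.inr ⟨i, ((_ : CoprodI A) : CoprodI A ⧸ _)⟩
        simp [mul_assoc]

lemma smul_inl (d : CoprodI A ⋊[factorAut φ] P) (x : CoprodI A) :
    d • (.inl x : Vertex A) = .inl (d.left * factorAut φ d.right x) := rfl

lemma smul_inr (d : CoprodI A ⋊[factorAut φ] P) (i : ι) (x : CoprodI A) :
    d • (.inr ⟨i, x⟩ : Vertex A) =
      .inr ⟨i, ((d.left * factorAut φ d.right x : CoprodI A) : CoprodI A ⧸ _)⟩ := rfl

lemma adj_smul (d : CoprodI A ⋊[factorAut φ] P) {u v : Vertex A} (h : (graph A).Adj u v) :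
    (graph A).Adj (d • u) (d • v) := by
  rcases h with ⟨x, i, rfl, rfl⟩ | ⟨x, i, rfl, rfl⟩
  · exact adj_inl_inr _ i
  · exact (adj_inl_inr _ i).symm

lemma actsSimplicially : ActsSimplicially (CoprodI A ⋊[factorAut φ] P) (graph A) := by
  refine ⟨fun d u v => ⟨fun h => by simpa using adj_smul d⁻¹ h, adj_smul d⟩, ?_⟩
  rintro d u v (⟨x, i, rfl, rfl⟩ | ⟨x, i, rfl, rfl⟩) ⟨h1, h2⟩
  · cases h1
  · cases h2

/-- An element fixing both endpoints of a long geodesic fixes two elements `x` and `y` of the free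
product between them, so its component in `P` fixes the letters of the normal form of
`x⁻¹ * y`. -/
lemma exists_letters_of_dist {u v : Vertex A} (huv : 5 ≤ (graph A).dist u v) :
    ∃ (x : CoprodI A) (i j : ι) (a : A i) (b : A j), i ≠ j ∧ a ≠ 1 ∧ b ≠ 1 ∧
      ∀ d : CoprodI A ⋊[factorAut φ] P, d • u = u → d • v = v →
        d • (.inl x : Vertex A) = .inl x ∧ φ i d.right a = a ∧ φ j d.right b = b := by
  have hX := isTree (A := A)
  have hG := actsSimplicially (φ := φ)
  have hnear : ∀ u v : Vertex A, 1 ≤ (graph A).dist u v → ∃ x : CoprodI A,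
      (graph A).dist u (.inl x) ≤ 1 ∧
      (graph A).dist u (.inl x) + (graph A).dist (.inl x) v = (graph A).dist u v := by
    intro u v h
    rcases u with x | ⟨i, q⟩
    · exact ⟨x, by simp⟩
    · obtain ⟨m, hm1, hm2⟩ := hX.connected.exists_dist_eq h
      rcases SimpleGraph.dist_eq_one_iff_adj.1 hm1 with ⟨x, j, h1, -⟩ | ⟨x, j, rfl, -⟩
      · cases h1
      · exact ⟨x, hm1.le, hm2⟩
  obtain ⟨x, hx1, hx2⟩ := hnear u v (by omega)
  obtain ⟨y, hy1, hy2⟩ := hnear v u (by rw [SimpleGraph.dist_comm]; omega)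
  obtain ⟨w, hw⟩ := CoprodI.Word.exists_prod_eq (x⁻¹ * y)
  have hlen : 2 ≤ w.toList.length := by
    have h1 := dist_mul_prod_le w x
    rw [hw, mul_inv_cancel_left] at h1
    have h2 := hX.connected.dist_triangle (u := u) (v := .inl x) (w := v)
    have h3 := hX.connected.dist_triangle (u := .inl x) (v := .inl y) (w := v)
    have h4 := (graph A).dist_comm (u := v) (v := .inl y)
    omega
  obtain ⟨l, l', L, hL⟩ : ∃ l l' L, w.toList = l :: l' :: L := by
    match h : w.toList with
    | [] => simp [h] at hlen
    | [_] => simp [h] at hlen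
    | l :: l' :: L => exact ⟨l, l', L, rfl⟩
  have hchain := w.chain_ne
  rw [hL, List.isChain_cons_cons] at hchain
  refine ⟨x, l.1, l'.1, l.2, l'.2, hchain.1, w.ne_one l (by simp [hL]), w.ne_one l' (by simp [hL]),
    fun d hu hv => ?_⟩
  have hconv := hG.isGeodConvex_fixedBy hX d
  have hdx : d • (.inl x : Vertex A) = .inl x := hconv u hu v hv _ hx2
  have hdy : d • (.inl y : Vertex A) = .inl y := hconv v hv u hu _ hy2
  have ex := Sum.inl_injective hdx
  have ey := Sum.inl_injective hdy
  have hfix : factorAut φ d.right (x⁻¹ * y) = x⁻¹ * y := by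
    calc factorAut φ d.right (x⁻¹ * y)
        = (d.left * factorAut φ d.right x)⁻¹ * (d.left * factorAut φ d.right y) := by
          rw [map_mul, map_inv]
          group
      _ = x⁻¹ * y := by rw [ex, ey]
  rw [← hw, factorAut_apply] at hfix
  have hletter : ∀ l ∈ w.toList, φ l.1 d.right l.2 = l.2 := fun l hl => by
    have h := CoprodI.Word.eq_of_lift_prod_eq (σ := id) Function.injective_id
      (θ := fun i => (φ i d.right).toMonoidHom) (fun i => (φ i d.right).injective) hfix hl
    exact eq_of_heq (Sigma.mk.inj_iff.1 h).2
  exact ⟨hdx, hletter l (by simp [hL]), hletter l' (by simp [hL])⟩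

/-- A product of non-trivial elements of two different factors fixes no vertex. -/
lemma inl_mul_smul_ne {i j : ι} (hij : i ≠ j) {a : A i} {b : A j} (ha : a ≠ 1) (hb : b ≠ 1)
    (v : Vertex A) :
    (SemidirectProduct.inl (CoprodI.of a * CoprodI.of b) : CoprodI A ⋊[factorAut φ] P) • v ≠ v := by
  classical
  set f : CoprodI A := CoprodI.of a * CoprodI.of b with hf
  let π : ∀ k, CoprodI A →* A k := fun k => CoprodI.lift (Pi.mulSingle k (MonoidHom.id (A k)))
  have hπ : ∀ {k l : ι} (h : l ≠ k) (m : A l), π k (CoprodI.of m) = 1 := fun h m => by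
    simp [π, Pi.mulSingle_eq_of_ne h]
  have hπa : π i f = a := by
    rw [hf, map_mul, hπ hij.symm, mul_one]
    exact CoprodI.of_leftInverse i a
  have hπb : π j f = b := by
    rw [hf, map_mul, hπ hij, one_mul]
    exact CoprodI.of_leftInverse j b
  rcases v with x | ⟨k, q⟩
  · rw [smul_inl]
    intro h
    have h1 := Sum.inl_injective h
    simp only [SemidirectProduct.left_inl, SemidirectProduct.right_inl, map_one, MulAut.one_apply,
      mul_eq_right] at h1
    rw [h1, map_one] at hπa
    exact ha hπa.symm
  · induction q using QuotientGroup.induction_on with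
    | H x =>
      rw [smul_inr]
      intro h
      have h1 := eq_of_heq (Sigma.mk.inj_iff.1 (Sum.inr_injective h)).2
      simp only [SemidirectProduct.left_inl, SemidirectProduct.right_inl, map_one,
        MulAut.one_apply] at h1
      obtain ⟨m, hm⟩ := QuotientGroup.eq.1 h1
      have h2 : ∀ l, k ≠ l → π l f = 1 := fun l hl => by
        have h3 := congrArg (π l) hm
        rw [hπ hl, map_mul, map_inv, map_mul, mul_inv_rev, mul_assoc, eq_comm,
          inv_mul_eq_one, eq_comm, inv_mul_eq_iff_eq_mul] at h3
        exact mul_eq_right.1 h3.symm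
      by_cases hk : k = i
      · exact hb (hπb.symm.trans (h2 j (by rw [hk]; exact hij)))
      · exact ha (hπa.symm.trans (h2 i hk))

end FreeProductTree

/-! ### Graph products, full subgroups and retractions -/

namespace GraphProduct

open Monoid

variable {V : Type*} {Γ : SimpleGraph V} {𝒢 : V → Type*} [∀ v, Group (𝒢 v)]

lemma commute_of {u v : V} (huv : Γ.Adj u v) (g : 𝒢 u) (h : 𝒢 v) :
    Commute (of Γ 𝒢 u g) (of Γ 𝒢 v h) := by
  have h1 : (CoprodI.of g * CoprodI.of h * (CoprodI.of g)⁻¹ * (CoprodI.of h)⁻¹ : CoprodI 𝒢) ∈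
      Subgroup.normalClosure (graphProductRels Γ 𝒢) :=
    Subgroup.subset_normalClosure ⟨u, v, g, h, huv, rfl⟩
  have h2 := (QuotientGroup.eq_one_iff _).2 h1
  rw [← commutatorElement_def] at h2
  exact commutatorElement_eq_one_iff_commute.1 h2

/-- The universal property of the graph product. -/
def lift {H : Type*} [Group H] (f : ∀ v, 𝒢 v →* H)
    (hf : ∀ u v, Γ.Adj u v → ∀ g h, Commute (f u g) (f v h)) : GraphProduct Γ 𝒢 →* H :=
  QuotientGroup.lift _ (CoprodI.lift f) (by
    refine Subgroup.normalClosure_le_normal ?_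
    rintro _ ⟨u, v, g, h, huv, rfl⟩
    rw [SetLike.mem_coe, MonoidHom.mem_ker]
    simp only [map_mul, map_inv, CoprodI.lift_of]
    exact commutatorElement_eq_one_iff_commute.2 (hf u v huv g h))

@[simp]
lemma lift_of {H : Type*} [Group H] (f : ∀ v, 𝒢 v →* H)
    (hf : ∀ u v, Γ.Adj u v → ∀ g h, Commute (f u g) (f v h)) (v : V) (g : 𝒢 v) :
    lift f hf (of Γ 𝒢 v g) = f v g :=
  CoprodI.lift_of f g

lemma hom_ext {H : Type*} [Group H] {f f' : GraphProduct Γ 𝒢 →* H}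
    (h : ∀ v g, f (of Γ 𝒢 v g) = f' (of Γ 𝒢 v g)) : f = f' := by
  refine QuotientGroup.monoidHom_ext _ (CoprodI.ext_hom _ _ fun v => ?_)
  ext g
  exact h v g

lemma exists_list (g : GraphProduct Γ 𝒢) :
    ∃ L : List (GraphProduct Γ 𝒢), (∀ x ∈ L, ∃ v y, of Γ 𝒢 v y = x) ∧ L.prod = g := by
  induction g using QuotientGroup.induction_on with
  | H x =>
    induction x using CoprodI.induction_on with
    | one => exact ⟨[], by simp, rfl⟩
    | of v y => exact ⟨[of Γ 𝒢 v y], fun x hx => ⟨v, y, (List.mem_singleton.1 hx).symm⟩,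
        List.prod_singleton⟩
    | mul x y hx hy =>
      obtain ⟨L, hL, h1⟩ := hx
      obtain ⟨L', hL', h2⟩ := hy
      refine ⟨L ++ L', fun z hz => ?_, ?_⟩
      · rcases List.mem_append.1 hz with h | h
        · exact hL z h
        · exact hL' z h
      · rw [List.prod_append, h1, h2]
        rfl

end GraphProduct

section FullSubgroups

variable {V : Type*} {Γ : SimpleGraph V} {𝒢 : V → Type*} [∀ v, Group (𝒢 v)]

open GraphProduct

lemma of_mem_fullSubgroup {S : Set V} {v : V} (hv : v ∈ S) (g : 𝒢 v) :
    of Γ 𝒢 v g ∈ fullSubgroup Γ 𝒢 S :=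
  (le_iSup₂ (f := fun v (_ : v ∈ S) => (of Γ 𝒢 v).range) v hv) ⟨g, rfl⟩

lemma fullSubgroup_le {S : Set V} {K : Subgroup (GraphProduct Γ 𝒢)}
    (h : ∀ v ∈ S, ∀ g, of Γ 𝒢 v g ∈ K) : fullSubgroup Γ 𝒢 S ≤ K := by
  refine iSup₂_le fun v hv => ?_
  rintro _ ⟨g, rfl⟩
  exact h v hv g

lemma commute_of_mem_fullSubgroup {S S' : Set V} (h : ∀ u ∈ S, ∀ v ∈ S', Γ.Adj u v)
    {x y : GraphProduct Γ 𝒢} (hx : x ∈ fullSubgroup Γ 𝒢 S) (hy : y ∈ fullSubgroup Γ 𝒢 S') :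
    Commute x y := by
  have h1 : fullSubgroup Γ 𝒢 S ≤ Subgroup.centralizer (fullSubgroup Γ 𝒢 S') := by
    refine fullSubgroup_le fun u hu g => ?_
    rw [Subgroup.mem_centralizer_iff]
    intro z hz
    have h2 : fullSubgroup Γ 𝒢 S' ≤ Subgroup.centralizer {of Γ 𝒢 u g} := by
      refine fullSubgroup_le fun v hv g' => ?_
      rw [Subgroup.mem_centralizer_singleton_iff]
      exact (commute_of (h u hu v hv) g g').eq.symm
    exact (Subgroup.mem_centralizer_singleton_iff.1 (h2 hz))
  exact (Subgroup.mem_centralizer_iff.1 (h1 hx) y hy).symm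

open scoped Classical in
/-- The retraction of the graph product to the full subgroup on `S` which kills the other vertex
groups. -/
noncomputable def retraction (Γ : SimpleGraph V) (𝒢 : V → Type*) [∀ v, Group (𝒢 v)] (S : Set V) :
    GraphProduct Γ 𝒢 →* GraphProduct Γ 𝒢 :=
  lift (fun v => if v ∈ S then of Γ 𝒢 v else 1) (fun u v huv g h => by
    split_ifs
    · exact commute_of huv g h
    · exact Commute.one_right _
    · exact Commute.one_left _
    · exact Commute.one_left _)

lemma retraction_of_mem {S : Set V} {v : V} (hv : v ∈ S) (g : 𝒢 v) :
    retraction Γ 𝒢 S (of Γ 𝒢 v g) = of Γ 𝒢 v g := by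
  simp [retraction, hv]

lemma retraction_of_notMem {S : Set V} {v : V} (hv : v ∉ S) (g : 𝒢 v) :
    retraction Γ 𝒢 S (of Γ 𝒢 v g) = 1 := by
  simp [retraction, hv]

lemma retraction_eq_self {S : Set V} {x : GraphProduct Γ 𝒢} (hx : x ∈ fullSubgroup Γ 𝒢 S) :
    retraction Γ 𝒢 S x = x := by
  have h : fullSubgroup Γ 𝒢 S ≤ (retraction Γ 𝒢 S).eqLocus (MonoidHom.id _) :=
    fullSubgroup_le fun v hv g => retraction_of_mem hv g
  exact h hx

lemma retraction_mem_inter (S : Set V) {S' : Set V} {x : GraphProduct Γ 𝒢}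
    (hx : x ∈ fullSubgroup Γ 𝒢 S') : retraction Γ 𝒢 S x ∈ fullSubgroup Γ 𝒢 (S ∩ S') := by
  have h : fullSubgroup Γ 𝒢 S' ≤ (fullSubgroup Γ 𝒢 (S ∩ S')).comap (retraction Γ 𝒢 S) := by
    refine fullSubgroup_le fun v hv g => ?_
    rw [Subgroup.mem_comap]
    by_cases hS : v ∈ S
    · rw [retraction_of_mem hS]
      exact of_mem_fullSubgroup (S := S ∩ S') ⟨hS, hv⟩ g
    · rw [retraction_of_notMem hS]
      exact one_mem _
  exact h hx

lemma disjoint_fullSubgroup {S S' : Set V} (h : Disjoint S S') :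
    Disjoint (fullSubgroup Γ 𝒢 S) (fullSubgroup Γ 𝒢 S') := by
  rw [Subgroup.disjoint_def]
  intro x hx hx'
  have h1 := retraction_mem_inter S hx'
  rw [retraction_eq_self hx, Set.disjoint_iff_inter_eq_empty.1 h] at h1
  have h2 : fullSubgroup Γ 𝒢 ∅ ≤ ⊥ := fullSubgroup_le fun v hv => hv.elim
  exact Subgroup.mem_bot.1 (h2 h1)

/-- The intersection of conjugates of the full subgroups on `S` and `S'` is conjugate into the full
subgroup on `S ∩ S'`. -/
lemma encard_stabilizer_cosets_le {S S' : Set V} (i : GraphProduct Γ 𝒢 ⧸ fullSubgroup Γ 𝒢 S)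
    (j : GraphProduct Γ 𝒢 ⧸ fullSubgroup Γ 𝒢 S') :
    {p : GraphProduct Γ 𝒢 | p • i = i ∧ p • j = j}.encard ≤
      (fullSubgroup Γ 𝒢 (S ∩ S') : Set (GraphProduct Γ 𝒢)).encard := by
  induction i using QuotientGroup.induction_on with
  | H x =>
    induction j using QuotientGroup.induction_on with
    | H y =>
      set z := x * retraction Γ 𝒢 S (x⁻¹ * y) with hz
      refine (Set.encard_le_encard (t := (fun r => z * r * z⁻¹) '' fullSubgroup Γ 𝒢 (S ∩ S'))
        ?_).trans (Set.encard_image_le _ _)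
      rintro p ⟨hx, hy⟩
      have hx' : (x⁻¹ * p * x)⁻¹ ∈ fullSubgroup Γ 𝒢 S := by
        have := QuotientGroup.eq.1 (show ((p * x : GraphProduct Γ 𝒢) : _ ⧸ fullSubgroup Γ 𝒢 S) =
          x from hx)
        convert this using 1
        group
      have hy' : (y⁻¹ * p * y)⁻¹ ∈ fullSubgroup Γ 𝒢 S' := by
        have := QuotientGroup.eq.1 (show ((p * y : GraphProduct Γ 𝒢) : _ ⧸ fullSubgroup Γ 𝒢 S') =
          y from hy)
        convert this using 1
        group
      rw [inv_mem_iff] at hx' hy'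
      refine ⟨_, retraction_mem_inter S hy', ?_⟩
      have h1 := retraction_eq_self hx'
      have h2 : x⁻¹ * p * x = (x⁻¹ * y) * (y⁻¹ * p * y) * (x⁻¹ * y)⁻¹ := by group
      rw [h2, map_mul, map_mul, map_inv, ← h2] at h1
      calc z * retraction Γ 𝒢 S (y⁻¹ * p * y) * z⁻¹
          = x * (retraction Γ 𝒢 S (x⁻¹ * y) * retraction Γ 𝒢 S (y⁻¹ * p * y) *
            (retraction Γ 𝒢 S (x⁻¹ * y))⁻¹) * x⁻¹ := by rw [hz]; group
        _ = p := by rw [h1]; group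

end FullSubgroups

/-! ### Free products of copies of a group permuted by another group -/

section Permuting

open Monoid

/-- `P` acts on the free product of copies of `H` indexed by `I` by permuting the copies. -/
def permAut (P I H : Type*) [Group P] [MulAction P I] [Group H] :
    P →* MulAut (CoprodI fun _ : I => H) :=
  MulAut.ofEndHom
    { toFun := fun p => CoprodI.lift fun i => (CoprodI.of (M := fun _ : I => H) (i := p • i))
      map_one' := by
        change CoprodI.lift _ = MonoidHom.id _
        refine CoprodI.ext_hom _ _ fun i => ?_
        ext h
        simp
      map_mul' := fun p q => by
        change _ = (CoprodI.lift fun i => CoprodI.of (M := fun _ : I => H) (i := p • i)).comp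
          (CoprodI.lift fun i => CoprodI.of (M := fun _ : I => H) (i := q • i))
        refine CoprodI.ext_hom _ _ fun i => ?_
        ext h
        simp [mul_smul] }

variable {P I H : Type*} [Group P] [MulAction P I] [Group H]

lemma permAut_of (p : P) (i : I) (h : H) :
    permAut P I H p (CoprodI.of (M := fun _ : I => H) (i := i) h) =
      CoprodI.of (M := fun _ : I => H) (i := p • i) h :=
  CoprodI.lift_of (fun i => CoprodI.of (M := fun _ : I => H) (i := p • i)) h

/-- A non-trivial element which is fixed by a permutation of the copies has letters in copies which
are fixed; the index `i` of such a letter does not depend on the permutation. -/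
lemma exists_index_fixed {m : CoprodI fun _ : I => H} (hm : m ≠ 1) :
    ∃ i : I, ∀ p : P, permAut P I H p m = m → p • i = i := by
  obtain ⟨w, rfl⟩ := CoprodI.Word.exists_prod_eq m
  obtain ⟨l, hl⟩ := List.exists_mem_of_ne_nil w.toList fun h => hm (by
    simp [CoprodI.Word.prod, h])
  refine ⟨l.1, fun p hp => ?_⟩
  have h := CoprodI.Word.eq_of_lift_prod_eq (M := fun _ : I => H) (σ := fun i => p • i)
    (MulAction.injective p) (θ := fun _ => MonoidHom.id H) (fun _ => Function.injective_id) hp hl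
  exact congrArg Sigma.fst h

end Permuting

/-! ### Embedding a graph product in a semidirect product acting on a tree -/

section Splitting

open Monoid GraphProduct

variable {V : Type*} (Γ : SimpleGraph V) (𝒢 : V → Type*) [∀ v, Group (𝒢 v)] (J : Set V)

/-- The free product of copies of the vertex group at `s`, one for each coset of the full subgroup
on the link of `s`. For cosets in the full subgroup on the complement of `J` this would be the
free product of the conjugates of the vertex group by this subgroup. All cosets in the
graph product are allowed instead, so that no graph product on a subgraph is needed; this only
enlarges the tree. -/
abbrev LinkFactor (s : J) : Type _ :=
  CoprodI fun _ : GraphProduct Γ 𝒢 ⧸ fullSubgroup Γ 𝒢 (Γ.neighborSet s) => 𝒢 s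

/-- The action of the graph product on the factor of `s ∈ J` by permuting the cosets of the full
subgroup on the link of `s`. -/
def linkAut (s : J) : GraphProduct Γ 𝒢 →* MulAut (LinkFactor Γ 𝒢 J s) :=
  permAut _ _ _

/-- The semidirect product into which the graph product embeds, for an independent set `J`. The
composite of the embedding with the projection to the right factor is not the identity but the
retraction which kills the vertex groups in `J`. -/
abbrev SplitGroup : Type _ :=
  CoprodI (LinkFactor Γ 𝒢 J) ⋊[FreeProductTree.factorAut (linkAut Γ 𝒢 J)] GraphProduct Γ 𝒢

variable {Γ 𝒢 J}

/-- The letter `g` of the vertex group at `s`, in the copy belonging to the coset `i`. -/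
def letter {s : J} (i : GraphProduct Γ 𝒢 ⧸ fullSubgroup Γ 𝒢 (Γ.neighborSet s)) :
    𝒢 s →* CoprodI (LinkFactor Γ 𝒢 J) :=
  (CoprodI.of (M := LinkFactor Γ 𝒢 J) (i := s)).comp (CoprodI.of (M := fun _ => 𝒢 s) (i := i))

lemma factorAut_letter (p : GraphProduct Γ 𝒢) {s : J}
    (i : GraphProduct Γ 𝒢 ⧸ fullSubgroup Γ 𝒢 (Γ.neighborSet s)) (g : 𝒢 s) :
    FreeProductTree.factorAut (linkAut Γ 𝒢 J) p (letter i g) = letter (p • i) g := by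
  change FreeProductTree.factorAut (linkAut Γ 𝒢 J) p (CoprodI.of (CoprodI.of g)) = _
  rw [FreeProductTree.factorAut_of, linkAut, permAut_of]
  rfl

open scoped Classical in
/-- The vertex groups in `J` are mapped to the free product, the others to the right factor. -/
noncomputable def splitOf (v : V) : 𝒢 v →* SplitGroup Γ 𝒢 J :=
  if h : v ∈ J then SemidirectProduct.inl.comp (letter (s := ⟨v, h⟩) (1 : GraphProduct Γ 𝒢))
  else SemidirectProduct.inr.comp (of Γ 𝒢 v)

lemma splitOf_of_mem {v : V} (h : v ∈ J) (g : 𝒢 v) :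
    (splitOf v g : SplitGroup Γ 𝒢 J) =
      SemidirectProduct.inl (letter (s := ⟨v, h⟩) (1 : GraphProduct Γ 𝒢) g) := by
  rw [splitOf, dif_pos h]
  rfl

lemma splitOf_of_notMem {v : V} (h : v ∉ J) (g : 𝒢 v) :
    (splitOf v g : SplitGroup Γ 𝒢 J) = SemidirectProduct.inr (of Γ 𝒢 v g) := by
  rw [splitOf, dif_neg h]
  rfl

lemma commute_splitOf_of_mem {u v : V} (huv : Γ.Adj u v) (hu : u ∈ J) (hv : v ∉ J) (g : 𝒢 u)
    (h : 𝒢 v) : Commute (splitOf u g : SplitGroup Γ 𝒢 J) (splitOf v h) := by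
  rw [splitOf_of_mem hu, splitOf_of_notMem hv]
  have h1 := SemidirectProduct.inl_aut (φ := FreeProductTree.factorAut (linkAut Γ 𝒢 J))
    (of Γ 𝒢 v h) (letter (s := ⟨u, hu⟩) (1 : GraphProduct Γ 𝒢) g)
  have h2 : of Γ 𝒢 v h • ((1 : GraphProduct Γ 𝒢) :
      GraphProduct Γ 𝒢 ⧸ fullSubgroup Γ 𝒢 (Γ.neighborSet u)) = (1 : GraphProduct Γ 𝒢) := by
    refine (QuotientGroup.eq.2 ?_).symm
    simpa using of_mem_fullSubgroup (Γ := Γ) (S := Γ.neighborSet u) huv h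
  rw [factorAut_letter] at h1
  erw [h2] at h1
  rw [map_inv, eq_mul_inv_iff_mul_eq] at h1
  exact h1

/-- The embedding of the graph product into the semidirect product. -/
noncomputable def splitHom (hJ : ∀ u ∈ J, ∀ v ∈ J, ¬ Γ.Adj u v) :
    GraphProduct Γ 𝒢 →* SplitGroup Γ 𝒢 J :=
  GraphProduct.lift splitOf fun u v huv g h => by
    by_cases hu : u ∈ J <;> by_cases hv : v ∈ J
    · exact (hJ u hu v hv huv).elim
    · exact commute_splitOf_of_mem huv hu hv g h
    · exact (commute_splitOf_of_mem huv.symm hv hu h g).symm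
    · rw [splitOf_of_notMem hu, splitOf_of_notMem hv]
      exact (commute_of huv g h).map _

/-- Substituting for the letters the corresponding conjugates in the graph product. -/
noncomputable def evalLetters : CoprodI (LinkFactor Γ 𝒢 J) →* GraphProduct Γ 𝒢 :=
  CoprodI.lift fun s => CoprodI.lift fun i => (MulAut.conj i.out).toMonoidHom.comp (of Γ 𝒢 s)

lemma evalLetters_letter {s : J} (x : GraphProduct Γ 𝒢) (g : 𝒢 s) :
    evalLetters (letter (s := s) (x : GraphProduct Γ 𝒢 ⧸ _) g) = x * of Γ 𝒢 s g * x⁻¹ := by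
  simp only [evalLetters, letter, MonoidHom.comp_apply, CoprodI.lift_of]
  obtain ⟨r, hr⟩ := QuotientGroup.mk_out_eq_mul (fullSubgroup Γ 𝒢 (Γ.neighborSet s)) x
  rw [hr]
  have hadj : ∀ u ∈ ({s.1} : Set V), ∀ v ∈ Γ.neighborSet s, Γ.Adj u v := fun u hu v hv => by
    rw [Set.mem_singleton_iff.1 hu]
    exact hv
  have h1 : Commute (of Γ 𝒢 s g) r := commute_of_mem_fullSubgroup hadj
    (of_mem_fullSubgroup (Set.mem_singleton s.1) g) r.2
  change x * r * of Γ 𝒢 s g * (x * r)⁻¹ = _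
  rw [mul_inv_rev, mul_assoc x, ← h1.eq]
  group

lemma splitHom_injective (hJ : ∀ u ∈ J, ∀ v ∈ J, ¬ Γ.Adj u v) :
    Function.Injective (splitHom (𝒢 := 𝒢) hJ) := by
  let χ : SplitGroup Γ 𝒢 J →* GraphProduct Γ 𝒢 :=
    SemidirectProduct.lift evalLetters (MonoidHom.id _) (fun p => by
      refine CoprodI.ext_hom _ _ fun s => CoprodI.ext_hom _ _ fun i => ?_
      ext g
      induction i using QuotientGroup.induction_on with
      | H x =>
        change evalLetters (FreeProductTree.factorAut (linkAut Γ 𝒢 J) p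
          (letter (s := s) (x : GraphProduct Γ 𝒢 ⧸ _) g)) =
          p * evalLetters (letter (s := s) (x : GraphProduct Γ 𝒢 ⧸ _) g) * p⁻¹
        rw [factorAut_letter, evalLetters_letter]
        refine (evalLetters_letter (p * x) g).trans ?_
        group)
  have h : χ.comp (splitHom hJ) = MonoidHom.id _ := by
    refine GraphProduct.hom_ext fun v g => ?_
    rw [MonoidHom.comp_apply, splitHom, GraphProduct.lift_of]
    by_cases hv : v ∈ J
    · rw [splitOf_of_mem hv, SemidirectProduct.lift_inl]
      exact (evalLetters_letter (s := ⟨v, hv⟩) 1 g).trans (by simp)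
    · rw [splitOf_of_notMem hv, SemidirectProduct.lift_inr]
  exact Function.LeftInverse.injective (g := χ) fun x => DFunLike.congr_fun h x

/-- The graph product acts on the Bass–Serre tree of the free product of the factors of `s ∈ J`. -/
@[reducible]
noncomputable def splitAction (hJ : ∀ u ∈ J, ∀ v ∈ J, ¬ Γ.Adj u v) :
    MulAction (GraphProduct Γ 𝒢) (FreeProductTree.Vertex (LinkFactor Γ 𝒢 J)) :=
  MulAction.compHom _ (splitHom hJ)

lemma splitAction_actsSimplicially (hJ : ∀ u ∈ J, ∀ v ∈ J, ¬ Γ.Adj u v) :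
    letI := splitAction (𝒢 := 𝒢) hJ
    ActsSimplicially (GraphProduct Γ 𝒢) (FreeProductTree.graph (LinkFactor Γ 𝒢 J)) := by
  have h := FreeProductTree.actsSimplicially (φ := linkAut Γ 𝒢 J)
  exact ⟨fun g => h.1 (splitHom hJ g), fun g => h.2 (splitHom hJ g)⟩

lemma splitAction_ne (hJ : ∀ u ∈ J, ∀ v ∈ J, ¬ Γ.Adj u v) {a b : V} (ha : a ∈ J) (hb : b ∈ J)
    (hab : a ≠ b) {x : 𝒢 a} {y : 𝒢 b} (hx : x ≠ 1) (hy : y ≠ 1)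
    (v : FreeProductTree.Vertex (LinkFactor Γ 𝒢 J)) :
    letI := splitAction (𝒢 := 𝒢) hJ
    (of Γ 𝒢 a x * of Γ 𝒢 b y) • v ≠ v := by
  have h : splitHom hJ (of Γ 𝒢 a x * of Γ 𝒢 b y) = SemidirectProduct.inl
      (letter (s := ⟨a, ha⟩) (1 : GraphProduct Γ 𝒢) x *
        letter (s := ⟨b, hb⟩) (1 : GraphProduct Γ 𝒢) y) := by
    rw [map_mul, splitHom, GraphProduct.lift_of, GraphProduct.lift_of, splitOf_of_mem ha,
      splitOf_of_mem hb, map_mul]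
  have h1 := FreeProductTree.inl_mul_smul_ne (φ := linkAut Γ 𝒢 J) (i := ⟨a, ha⟩) (j := ⟨b, hb⟩)
    (fun h => hab (congrArg Subtype.val h))
    (a := CoprodI.of (M := fun _ => 𝒢 a) (i := ((1 : GraphProduct Γ 𝒢) : GraphProduct Γ 𝒢 ⧸ _)) x)
    (b := CoprodI.of (M := fun _ => 𝒢 b) (i := ((1 : GraphProduct Γ 𝒢) : GraphProduct Γ 𝒢 ⧸ _)) y)
    ((map_ne_one_iff _ (CoprodI.of_injective _)).2 hx)
    ((map_ne_one_iff _ (CoprodI.of_injective _)).2 hy) v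
  change splitHom hJ (of Γ 𝒢 a x * of Γ 𝒢 b y) • v ≠ v
  rw [h]
  exact h1

/-- If the common links of any two vertices of `J` generate finite subgroups of bounded order, then
the action on the tree is acylindrical: an element fixing the ends of a long geodesic is determined
by its image under the retraction, which lies in the intersection of conjugates of the full
subgroups on the links of two different vertices of `J`. -/
lemma splitAction_actsAcylindrically (hJ : ∀ u ∈ J, ∀ v ∈ J, ¬ Γ.Adj u v) (C : ℕ)
    (hC : ∀ u ∈ J, ∀ v ∈ J, u ≠ v →
      (fullSubgroup Γ 𝒢 (Γ.commonNeighbors u v) : Set (GraphProduct Γ 𝒢)).encard ≤ C) :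
    letI := splitAction (𝒢 := 𝒢) hJ
    ActsAcylindrically (GraphProduct Γ 𝒢) (FreeProductTree.graph (LinkFactor Γ 𝒢 J)) := by
  let := splitAction (𝒢 := 𝒢) hJ
  refine (splitAction_actsSimplicially hJ).actsAcylindrically FreeProductTree.isTree 5 C
    fun u v huv => ?_
  obtain ⟨x, s, s', a, b, hs, ha, hb, h⟩ :=
    FreeProductTree.exists_letters_of_dist (φ := linkAut Γ 𝒢 J) huv
  obtain ⟨i, hi⟩ := exists_index_fixed (P := GraphProduct Γ 𝒢) ha
  obtain ⟨j, hj⟩ := exists_index_fixed (P := GraphProduct Γ 𝒢) hb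
  have hinj : Set.InjOn (fun g => (splitHom hJ g).right) {g : GraphProduct Γ 𝒢 | g • u = u ∧ g • v = v} := by
    intro g hg g' hg' heq
    apply splitHom_injective hJ
    have h1 := Sum.inl_injective (h (splitHom hJ g) hg.1 hg.2).1
    have h2 := Sum.inl_injective (h (splitHom hJ g') hg'.1 hg'.2).1
    have heq' : (splitHom hJ g).right = (splitHom hJ g').right := heq
    refine SemidirectProduct.ext ?_ heq'
    rw [heq'] at h1
    exact mul_right_cancel (h1.trans h2.symm)
  rw [← hinj.encard_image]
  refine (Set.encard_le_encard ?_).trans ((encard_stabilizer_cosets_le i j).trans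
    (hC s s.2 s' s'.2 fun h => hs (Subtype.ext h)))
  rintro _ ⟨g, hg, rfl⟩
  obtain ⟨-, h1, h2⟩ := h (splitHom hJ g) hg.1 hg.2
  exact ⟨hi _ h1, hj _ h2⟩

end Splitting

/-! ### Separated pairs and acylindrical arboreality -/

section SeparatedPairs

open Monoid GraphProduct

variable {V : Type*} {Γ : SimpleGraph V} {𝒢 : V → Type*} [∀ v, Group (𝒢 v)]

lemma two_le_edist_iff {a b : V} : 2 ≤ Γ.edist a b ↔ a ≠ b ∧ ¬ Γ.Adj a b := by
  rw [← not_lt, show (2 : ℕ∞) = 1 + 1 by norm_num, ENat.lt_add_one_iff (by simp),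
    SimpleGraph.edist_le_one_iff_adj_or_eq]
  tauto

lemma independent_pair {a b : V} (hab : ¬ Γ.Adj a b) :
    ∀ u ∈ ({a, b} : Set V), ∀ v ∈ ({a, b} : Set V), ¬ Γ.Adj u v := by
  rintro u (rfl | rfl) v (rfl | rfl)
  · exact Γ.irrefl
  · exact hab
  · exact fun h => hab h.symm
  · exact Γ.irrefl

/-- Two non-adjacent vertex groups generate an infinite subgroup: products of non-trivial elements
of the two groups are hyperbolic on the tree. -/
lemma infinite_fullSubgroup_pair {a b : V} (hne : a ≠ b) (hab : ¬ Γ.Adj a b) [Nontrivial (𝒢 a)]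
    [Nontrivial (𝒢 b)] : Infinite (fullSubgroup Γ 𝒢 {a, b}) := by
  obtain ⟨x, hx⟩ := exists_ne (1 : 𝒢 a)
  obtain ⟨y, hy⟩ := exists_ne (1 : 𝒢 b)
  have hJ := independent_pair hab
  let := splitAction (𝒢 := 𝒢) hJ
  have hX := FreeProductTree.isTree (A := LinkFactor Γ 𝒢 {a, b})
  obtain ⟨l, hl⟩ := (splitAction_actsSimplicially (𝒢 := 𝒢) hJ).exists_translatesBy hX
    (splitAction_ne hJ (by simp) (by simp) hne hx hy)
  have hmem : of Γ 𝒢 a x * of Γ 𝒢 b y ∈ fullSubgroup Γ 𝒢 {a, b} :=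
    mul_mem (of_mem_fullSubgroup (by simp) x) (of_mem_fullSubgroup (by simp) y)
  have hord : ¬ IsOfFinOrder (of Γ 𝒢 a x * of Γ 𝒢 b y) := fun h => by
    obtain ⟨n, hn, hn1⟩ := isOfFinOrder_iff_pow_eq_one.1 h
    exact hl.zpow_ne_one hX (n := n) (by omega) (by rwa [zpow_natCast])
  have hinj := injective_pow_iff_not_isOfFinOrder.2 hord
  exact Infinite.of_injective
    (fun n : ℕ => (⟨_, pow_mem hmem n⟩ : fullSubgroup Γ 𝒢 {a, b}))
    fun m n h => hinj (congrArg Subtype.val h)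

/-- A separated pair yields a non-elementary acylindrical action, unless the graph product is
virtually cyclic. -/
lemma isAcylindricallyArboreal_of_areSeparated [∀ v, Nontrivial (𝒢 v)]
    (hvc : ¬ IsVirtuallyCyclic (GraphProduct Γ 𝒢)) {a b : V} (h : AreSeparated Γ 𝒢 a b) :
    IsAcylindricallyArboreal (GraphProduct Γ 𝒢) := by
  obtain ⟨hne, hab⟩ := two_le_edist_iff.1 h.1
  obtain ⟨x, hx⟩ := exists_ne (1 : 𝒢 a)
  obtain ⟨y, hy⟩ := exists_ne (1 : 𝒢 b)
  have hJ := independent_pair hab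
  have hC : ∀ u ∈ ({a, b} : Set V), ∀ v ∈ ({a, b} : Set V), u ≠ v →
      (fullSubgroup Γ 𝒢 (Γ.commonNeighbors u v) : Set (GraphProduct Γ 𝒢)).encard ≤
        ((fullSubgroup Γ 𝒢 (Γ.commonNeighbors a b) : Set (GraphProduct Γ 𝒢)).ncard : ℕ) := by
    rintro u (rfl | rfl) v (rfl | rfl) huv
    · exact (huv rfl).elim
    · rw [h.2.cast_ncard_eq]
    · rw [h.2.cast_ncard_eq, SimpleGraph.commonNeighbors_symm]
    · exact (huv rfl).elim
  let := splitAction (𝒢 := 𝒢) hJ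
  have hX := FreeProductTree.isTree (A := LinkFactor Γ 𝒢 {a, b})
  have hG := splitAction_actsSimplicially (𝒢 := 𝒢) hJ
  have hA := splitAction_actsAcylindrically hJ _ hC
  exact ⟨_, this, _, hX, hG, hA,
    hA.actsNonElementarily hX hG (splitAction_ne hJ (by simp) (by simp) hne hx hy) hvc⟩

/-- In an acylindrical action of the graph product on a tree, the elements of a full subgroup have
fixed vertices if this set of vertices is joined to another one with an infinite full subgroup. -/
lemma exists_fixed_of_mem_fullSubgroup {T : Type*} [MulAction (GraphProduct Γ 𝒢) T]
    {X : SimpleGraph T} (hX : X.IsTree) (hG : ActsSimplicially (GraphProduct Γ 𝒢) X)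
    (hA : ActsAcylindrically (GraphProduct Γ 𝒢) X) {S S' : Set V}
    (hS : ∀ u ∈ S, ∀ v ∈ S', Γ.Adj u v) (hinf : Infinite (fullSubgroup Γ 𝒢 S'))
    {g : GraphProduct Γ 𝒢} (hg : g ∈ fullSubgroup Γ 𝒢 S) : ∃ x : T, g • x = x := by
  by_contra! hno
  obtain ⟨l, hl⟩ := hG.exists_translatesBy hX hno
  have hdisj : Disjoint S S' := Set.disjoint_left.2 fun u hu hu' => Γ.irrefl (hS u hu u hu')
  have := hl.finite_of_commute hX hG hA
    (fun k hk => (commute_of_mem_fullSubgroup hS hg hk).symm)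
    ((disjoint_fullSubgroup hdisj).mono_left ((Subgroup.zpowers_le).2 hg))
  exact not_finite (fullSubgroup Γ 𝒢 S')

/-- Without separated pairs no element of the graph product is loxodromic: any two elements of
vertex groups have a common fixed vertex, so all their products have fixed vertices. -/
lemma exists_areSeparated [∀ v, Nontrivial (𝒢 v)] (hdiam : 2 ≤ Γ.ediam)
    (h : IsAcylindricallyArboreal (GraphProduct Γ 𝒢)) : ∃ a b : V, AreSeparated Γ 𝒢 a b := by
  by_contra! hsep
  obtain ⟨T, _, X, hX, hG, hA, S, hS, hlox, -⟩ := h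
  have hinf : ∀ {u v : V}, u ≠ v → ¬ Γ.Adj u v →
      Infinite (fullSubgroup Γ 𝒢 (Γ.commonNeighbors u v)) := fun hne huv =>
    Set.infinite_coe_iff.2 fun hfin => hsep _ _ ⟨two_le_edist_iff.2 ⟨hne, huv⟩, hfin⟩
  have hpair : ∀ {u v : V}, u ≠ v → ¬ Γ.Adj u v → ∀ g ∈ fullSubgroup Γ 𝒢 {u, v},
      ∃ x : T, g • x = x := fun hne huv g hg => by
    refine exists_fixed_of_mem_fullSubgroup hX hG hA ?_ (hinf hne huv) hg
    rintro _ (rfl | rfl) w hw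
    · exact hw.1
    · exact hw.2
  obtain ⟨a, b, hab⟩ : ∃ a b : V, 2 ≤ Γ.edist a b := by
    by_contra! hlt
    have : Γ.ediam ≤ 1 := SimpleGraph.ediam_le_of_edist_le fun u v =>
      ENat.lt_add_one_iff (by simp) |>.1 ((hlt u v).trans_eq (by norm_num))
    exact absurd (hdiam.trans this) (by norm_num)
  rw [two_le_edist_iff] at hab
  have hvertex : ∀ (v : V) (g : 𝒢 v), ∃ x : T, of Γ 𝒢 v g • x = x := fun v g => by
    by_cases hv : ∃ u, v ≠ u ∧ ¬ Γ.Adj v u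
    · obtain ⟨u, hne, huv⟩ := hv
      exact hpair hne huv _ (of_mem_fullSubgroup (by simp) g)
    · push Not at hv
      have hav : v ≠ a := fun hva => hab.2 (hva ▸ hv b (hva ▸ hab.1))
      have hbv : v ≠ b := fun hvb => hab.2 (hvb ▸ (hv a (hvb ▸ hab.1.symm)).symm)
      refine exists_fixed_of_mem_fullSubgroup hX hG hA (S := {v}) (S' := {a, b}) ?_
        (infinite_fullSubgroup_pair hab.1 hab.2) (of_mem_fullSubgroup (Set.mem_singleton v) g)
      rintro _ rfl _ (rfl | rfl)
      · exact hv _ hav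
      · exact hv _ hbv
  have hcommon : ∀ (u v : V) (g : 𝒢 u) (h : 𝒢 v),
      ∃ x : T, of Γ 𝒢 u g • x = x ∧ of Γ 𝒢 v h • x = x := fun u v g h => by
    refine hG.exists_common_fixed hX (hvertex u g) (hvertex v h) ?_
    rcases eq_or_ne u v with rfl | hne
    · rw [← map_mul]
      exact hvertex u _
    by_cases huv : Γ.Adj u v
    · exact hG.exists_fixed_mul_of_commute hX (commute_of huv g h) (hvertex u g) (hvertex v h)
    · exact hpair hne huv _
        (mul_mem (of_mem_fullSubgroup (by simp) g) (of_mem_fullSubgroup (by simp) h))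
  obtain ⟨g, hg⟩ := hS.nonempty
  obtain ⟨L, hL, rfl⟩ := exists_list g
  obtain ⟨x, hx⟩ := hG.exists_fixed_list_prod hX L fun g hg h hh => by
    obtain ⟨u, g, rfl⟩ := hL g hg
    obtain ⟨v, h, rfl⟩ := hL h hh
    exact hcommon u v g h
  exact (hlox _ hg).not_fixed x hx

end SeparatedPairs

theorem theorem1p1 {V : Type*} [Finite V] (Γ : SimpleGraph V)
    (𝒢 : V → Type*) [∀ v, Group (𝒢 v)] [∀ v, Countable (𝒢 v)]
    (hnd : IsNonDegenerate Γ 𝒢) (hdiam : 2 ≤ Γ.ediam) :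
    IsAcylindricallyArboreal (GraphProduct Γ 𝒢) ↔
      ¬ IsVirtuallyCyclic (GraphProduct Γ 𝒢) ∧ ∃ a b : V, AreSeparated Γ 𝒢 a b := by
  have := hnd.1
  constructor
  · intro h
    refine ⟨?_, exists_areSeparated hdiam h⟩
    obtain ⟨T, _, X, hX, hG, -, hne⟩ := h
    exact hne.not_isVirtuallyCyclic hX hG
  · rintro ⟨hvc, a, b, hab⟩
    exact isAcylindricallyArboreal_of_areSeparated hvc hab
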